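/- **Setting.** For $d\times d$ complex invertible matrices with $A^tB-B^tA=0$ and $A^*B+B^*A=2I$, for $a,\eta\in\mathbb R^d$ and $\hbar>0$, let $$\phi_0(A,B,\hbar,a,\eta,x)=(\pi\hbar)^{-d/4}(\det A)^{-1/2}\exp\Big\{-\frac{\langle x-a,BA^{-1}(x-a)\rangle}{2\hbar}+\frac{i\langle\eta,x-a\rangle}{\hbar}\Big\},$$ and for a multi-index $j$ let $\phi_j=(j!)^{-1/2}(\mathcal A_1^*)^{j_1}\cdots(\mathcal A_d^*)^{j_d}\phi_0$, where $$\mathcal A_m^*=\frac1{\sqrt{2\hbar}}\Big[\sum_n\overline{B}_{nm}(x_n-a_n)-i\sum_n\overline{A}_{nm}\Big(-i\hbar\frac{\partial}{\partial x_n}-\eta_n\Big)\Big].$$ **Hypotheses.** Let $V:\mathbb R^d\to\mathbb R$ be bounded below. Assume that, for some $\delta,M,\tau>0$, $V$ extends to an analytic function in a neighborhood of $S_\delta=\{z\in\mathbb C^d:|\mathrm{Im}\,z_j|\le\delta\ \text{for all } j\}$ with $|V(z)|\le M\exp(\tau|z|^2)$ on $S_\delta$. Fix $T>0$ and, on $[0,T]$,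 a solution of $$\dot a=\eta,\quad \dot\eta=-\nabla V(a),\quad \dot A=iB,\quad \dot B=iV^{(2)}(a)A,\quad \dot S=\tfrac12|\eta|^2-V(a),$$ where $V^{(2)}$ is the Hessian of $V$, $S(0)=0$, and $A(0),B(0)$ are invertible and satisfy the two matrix conditions above. Choose $(\det A(t))^{1/2}$ continuous in $t$, and write $\phi_j(t)=\phi_j(A(t),B(t),\hbar,a(t),\eta(t),\cdot)$. Fix $J\ge0$ and complex numbers $c_j(0)$, zero for $|j|>J$, with $\sum_{|j|\le J}|c_j(0)|^2=1$. **Approximate wave packet.** Let $X(t)^m$ be the infinite matrix with entries $\hbar^{-|m|/2}\langle\phi_j(t),(x-a(t))^m\phi_i(t)\rangle$ (these do not depend on $\hbar$), and let $K_k(t)=\sum_{|m|=k}\frac{(D^mV)(a(t))}{m!}X(t)^m$. Let the vectors $c_n(t)=(c_{n,j}(t))_j$ be determined recursively by $$i\,\dot c_n=\sum_{k=0}^{n-1}K_{n+2-k}(t)\,c_k(t),\qquad c_{0,j}(0)=c_j(0),\qquad c_n(0)=0\ \ (n\ge1).$$ For $g>0$ and $l=\lfloor g/\hbar\rfloor$,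 put $$\psi(x,t,\hbar)=e^{iS(t)/\hbar}\sum_{|j|\le J+3l-3}\Big(\sum_{k=0}^{l-1}\hbar^{k/2}c_{k,j}(t)\Big)\phi_j(A(t),B(t),\hbar,a(t),\eta(t),x),$$ which is $0$ if $l=0$. **Theorem.** Let $b>0$. There is a number $G>0$ such that for every $g\in(0,G)$ there is a number $\Gamma_g>0$ such that, for all $\hbar>0$ and all $t\in[0,T]$, the function $|\psi(\cdot,t,\hbar)|^2$ is integrable on $\{x:|x-a(t)|>b\}$ and $$\Big(\int_{|x-a(t)|>b}|\psi(x,t,\hbar)|^2\,dx\Big)^{1/2}\le\exp\{-\Gamma_g/\hbar\}.$$ -/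

import Mathlib

namespace SemiclassicalPacket

open MeasureTheory Matrix
open scoped ComplexConjugate

noncomputable section

/-- The configuration space `ℝ^d` with its Euclidean norm. -/
abbrev Conf (d : ℕ) := EuclideanSpace ℝ (Fin d)

/-- Multi-indices `j = (j_1, …, j_d)` of non-negative integers. -/
abbrev MIdx (d : ℕ) := Fin d → ℕ

/-- `|j| = j_1 + ⋯ + j_d`. -/
def order {d : ℕ} (j : MIdx d) : ℕ := ∑ n, j n

/-- `j! = j_1! ⋯ j_d!`. -/
def mfact {d : ℕ} (j : MIdx d) : ℕ := ∏ n, (j n).factorial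

/-- The finite set of multi-indices with `|j| = k`. -/
def idxEq (d k : ℕ) : Finset (MIdx d) := Finset.piAntidiag Finset.univ k

/-- The finite set of multi-indices with `|j| ≤ N`. -/
def idxLe (d N : ℕ) : Finset (MIdx d) := (Finset.range (N + 1)).biUnion (idxEq d)

theorem mem_idxEq {d k : ℕ} {j : MIdx d} : j ∈ idxEq d k ↔ order j = k := by
  simp [idxEq, order]

theorem mem_idxLe {d N : ℕ} {j : MIdx d} : j ∈ idxLe d N ↔ order j ≤ N := by
  simp [idxLe, mem_idxEq]

/-- `T_1^{j_1} (T_2^{j_2} ( ⋯ (T_d^{j_d} f)))` for a family of operators `T_1, …, T_d`. -/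
def iterOp {d : ℕ} {F : Type*} (T : Fin d → F → F) (j : MIdx d) (f : F) : F :=
  (List.finRange d).foldr (fun n g => (T n)^[j n] g) f

/-- The partial derivative `∂f/∂x_n`. -/
def partialD {d : ℕ} {F : Type*} [NormedAddCommGroup F] [NormedSpace ℝ F]
    (n : Fin d) (f : Conf d → F) : Conf d → F :=
  fun x => fderiv ℝ f x (EuclideanSpace.single n 1)

/-- `D^m f`. -/
def multiD {d : ℕ} (m : MIdx d) (f : Conf d → ℝ) : Conf d → ℝ := iterOp partialD m f

/-- The monomial `(x - a)^m`. -/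
def monomial {d : ℕ} (m : MIdx d) (a x : Conf d) : ℝ := ∏ n, (x n - a n) ^ m n

/-- The Hessian matrix `V^{(2)}(x)`. -/
def hessian {d : ℕ} (V : Conf d → ℝ) (x : Conf d) : Matrix (Fin d) (Fin d) ℝ :=
  Matrix.of fun i j => partialD i (partialD j V) x

/-- The parameters `A, B, a, η` of a wave packet. The field `rootDet` is the square root of `det A`
that is used in the normalization of the Gaussian. -/
structure PacketData (d : ℕ) where
  A : Matrix (Fin d) (Fin d) ℂ
  B : Matrix (Fin d) (Fin d) ℂ
  a : Conf d
  η : Conf d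
  rootDet : ℂ

/-- `A` and `B` are invertible, `Aᵗ B - Bᵗ A = 0` and `A^* B + B^* A = 2 I`. -/
structure Admissible {d : ℕ} (A B : Matrix (Fin d) (Fin d) ℂ) : Prop where
  unit_A : IsUnit A.det
  unit_B : IsUnit B.det
  symm : Aᵀ * B - Bᵀ * A = 0
  herm : Aᴴ * B + Bᴴ * A = (2 : ℂ) • (1 : Matrix (Fin d) (Fin d) ℂ)

/-- The Gaussian
`φ_0 = π^{-d/4} ħ^{-d/4} (det A)^{-1/2}
  exp (-⟨x - a, B A⁻¹ (x - a)⟩ / (2ħ) + i ⟨η, x - a⟩ / ħ)`. -/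
def phiZero {d : ℕ} (p : PacketData d) (h : ℝ) (x : Conf d) : ℂ :=
  let v : Fin d → ℂ := fun n => ((x n - p.a n : ℝ) : ℂ)
  let w : Fin d → ℂ := fun n => ((p.η n : ℝ) : ℂ)
  ((Real.pi ^ (-(d : ℝ) / 4) * h ^ (-(d : ℝ) / 4) : ℝ) : ℂ) * p.rootDet⁻¹ *
    Complex.exp (-(v ⬝ᵥ ((p.B * p.A⁻¹) *ᵥ v)) / (2 * (h : ℂ))
      + Complex.I * (w ⬝ᵥ v) / (h : ℂ))

/-- The raising operator
`(2ħ)^{-1/2} [ ∑_n conj(B_{nm}) (x_n - a_n) - i ∑_n conj(A_{nm}) (-iħ ∂_n - η_n) ]`. -/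
def raising {d : ℕ} (p : PacketData d) (h : ℝ) (m : Fin d) (f : Conf d → ℂ) : Conf d → ℂ :=
  fun x => ((1 / Real.sqrt (2 * h) : ℝ) : ℂ) *
    ((∑ n, conj (p.B n m) * ((x n - p.a n : ℝ) : ℂ) * f x)
      - Complex.I * ∑ n, conj (p.A n m) *
          (-Complex.I * (h : ℂ) * partialD n f x - ((p.η n : ℝ) : ℂ) * f x))

/-- The wave packet `φ_j(A, B, ħ, a, η, ·)`. -/
def phi {d : ℕ} (p : PacketData d) (h : ℝ) (j : MIdx d) : Conf d → ℂ :=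
  fun x => ((1 / Real.sqrt (mfact j) : ℝ) : ℂ) * iterOp (raising p h) j (phiZero p h) x

/-- The equations of motion on `[0, T]`,
`ȧ = η`, `η̇ = -∇V(a)`, `Ȧ = iB`, `Ḃ = i V^{(2)}(a) A`, `Ṡ = |η|²/2 - V(a)`,
with admissible initial matrices and `S(0) = 0`; the square root of `det A(t)` is continuous. -/
structure IsClassicalFlow {d : ℕ} (V : Conf d → ℝ) (T : ℝ)
    (p : ℝ → PacketData d) (S : ℝ → ℝ) : Prop where
  init : Admissible (p 0).A (p 0).B
  init_S : S 0 = 0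
  deriv_a : ∀ t ∈ Set.Icc 0 T,
    HasDerivWithinAt (fun s => (p s).a) (p t).η (Set.Icc 0 T) t
  deriv_η : ∀ t ∈ Set.Icc 0 T,
    HasDerivWithinAt (fun s => (p s).η) (-gradient V (p t).a) (Set.Icc 0 T) t
  deriv_A : ∀ t ∈ Set.Icc 0 T, ∀ i j,
    HasDerivWithinAt (fun s => (p s).A i j) (Complex.I * (p t).B i j) (Set.Icc 0 T) t
  deriv_B : ∀ t ∈ Set.Icc 0 T, ∀ i j,
    HasDerivWithinAt (fun s => (p s).B i j)
      (Complex.I * ((hessian V (p t).a).map (fun y : ℝ => (y : ℂ)) * (p t).A) i j)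
      (Set.Icc 0 T) t
  deriv_S : ∀ t ∈ Set.Icc 0 T,
    HasDerivWithinAt S (‖(p t).η‖ ^ 2 / 2 - V (p t).a) (Set.Icc 0 T) t
  root_sq : ∀ t ∈ Set.Icc 0 T, (p t).rootDet ^ 2 = (p t).A.det
  root_cont : ContinuousOn (fun t => (p t).rootDet) (Set.Icc 0 T)

/-- The point of `ℂ^d` with real coordinates `x`. -/
def complexify {d : ℕ} (x : Conf d) : EuclideanSpace ℂ (Fin d) :=
  WithLp.toLp 2 fun n => ((x n : ℝ) : ℂ)

/-- The region `S_δ = {z : |Im z_j| ≤ δ for all j}`. -/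
def strip (d : ℕ) (δ : ℝ) : Set (EuclideanSpace ℂ (Fin d)) := {z | ∀ n, |(z n).im| ≤ δ}

/-- `V` extends to a function that is analytic in a neighbourhood of `S_δ` and satisfies
`|V(z)| ≤ M exp(τ |z|²)` on `S_δ`. -/
def HasStripExtension {d : ℕ} (V : Conf d → ℝ) (δ M τ : ℝ) : Prop :=
  ∃ (U : Set (EuclideanSpace ℂ (Fin d))) (F : EuclideanSpace ℂ (Fin d) → ℂ),
    IsOpen U ∧ strip d δ ⊆ U ∧ AnalyticOnNhd ℂ F U ∧
    (∀ x, F (complexify x) = (V x : ℂ)) ∧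
    ∀ z ∈ strip d δ, ‖F z‖ ≤ M * Real.exp (τ * ‖z‖ ^ 2)

/-- The `(j, i)` entry of `X^m`, the infinite matrix that represents `ħ^{-|m|/2} (x - a)^m` in the
basis `φ_j`. -/
def Xmat {d : ℕ} (p : PacketData d) (h : ℝ) (m j i : MIdx d) : ℂ :=
  ((h ^ (-(order m : ℝ) / 2) : ℝ) : ℂ) *
    ∫ x, conj (phi p h j x) * ((monomial m p.a x : ℝ) : ℂ) * phi p h i x

/-- The `(j, i)` entry of `K_k = ∑_{|m| = k} (D^m V)(a) / m! X^m`. -/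
def Kmat {d : ℕ} (V : Conf d → ℝ) (p : PacketData d) (h : ℝ) (k : ℕ) (j i : MIdx d) : ℂ :=
  ∑ m ∈ idxEq d k, ((multiD m V p.a / (mfact m : ℝ) : ℝ) : ℂ) * Xmat p h m j i

/-- The coefficient `c_{n,j}(t)`: the solution, obtained by integration, of
`i ċ_n = ∑_{k < n} K_{n+2-k} c_k` with `c_0(0) = c₀` and `c_n(0) = 0` for `n ≥ 1`. The entries of the
`K_k`, hence these coefficients, do not depend on the value of `ħ`. -/
def coeff {d : ℕ} (V : Conf d → ℝ) (p : ℝ → PacketData d) (h : ℝ) (c₀ : MIdx d → ℂ) :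
    ℕ → ℝ → MIdx d → ℂ
  | n => fun t j =>
      (if n = 0 then c₀ j else 0) - Complex.I *
        ∫ s in (0 : ℝ)..t, ∑ k : Fin n, ∑' i : MIdx d,
          Kmat V (p s) h (n + 2 - (k : ℕ)) j i * coeff V p h c₀ (k : ℕ) s i
  termination_by n => n
  decreasing_by exact k.2

/-- The truncated expansion, with `l` terms,
`e^{iS(t)/ħ} ∑_{|j| ≤ J + 3(l-1)} (∑_{k < l} ħ^{k/2} c_{k,j}(t)) φ_j(A(t), B(t), ħ, a(t), η(t), x)`. -/
def truncatedPacket {d : ℕ} (V : Conf d → ℝ) (p : ℝ → PacketData d) (S : ℝ → ℝ) (J : ℕ)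
    (c₀ : MIdx d → ℂ) (l : ℕ) (h t : ℝ) (x : Conf d) : ℂ :=
  Complex.exp (Complex.I * (S t : ℂ) / (h : ℂ)) *
    ∑ j ∈ idxLe d (J + 3 * (l - 1)),
      (∑ k ∈ Finset.range l, ((h ^ ((k : ℝ) / 2) : ℝ) : ℂ) * coeff V p h c₀ k t j) *
        phi (p t) h j x

/-- The approximate solution: the expansion truncated at `l(ħ) = ⌊g / ħ⌋` terms. -/
def approxPacket {d : ℕ} (V : Conf d → ℝ) (p : ℝ → PacketData d) (S : ℝ → ℝ) (J : ℕ)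
    (c₀ : MIdx d → ℂ) (g h t : ℝ) (x : Conf d) : ℂ :=
  truncatedPacket V p S J c₀ ⌊g / h⌋₊ h t x

end

end SemiclassicalPacket

namespace SemiclassicalPacket

open MeasureTheory Matrix
open scoped ComplexConjugate

noncomputable section

variable {d : ℕ}

open MvPolynomial (pderiv)

/-! In the complex coordinates w = √(2/ħ) A⁻¹(x − a) every state φ_j is a polynomial in w times the
Gaussian, and the raising operators become R_m = w_m − ∑_k S_{km} ∂_k with S = A⁻¹ conj(A), free of
ħ (`phi_eq_polyPacket`). Symmetry of S makes the R_m commute, and [∂_m, R_n] = δ_{mn}. The rescaled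
position (x_n − a_n)/√ħ is a combination of the R_k and ∂_k. On combinations of states of order at
most N it therefore raises the order by at most one and multiplies the ℓ¹ norm of the coefficients
by at most a constant times √(N + 1) (`HasExpansion.posPoly_mul`).

The coefficients grow in a controlled way. Cauchy estimates bound the Taylor coefficients of V by C
r^|m|, uniformly along the compact trajectory (`exists_taylor_bound`), so column i of K_k has ℓ¹
norm at most a constant times (κ √(|i| + k))^k (`sum_norm_Kmat_le`). Induction on n ≤ l bounds the
ℓ¹ norm of c_n(t) by D (2ν √l)^n exp(ω l t) (`sum_norm_coeff_le`). Since ħ l ≤ g ≤ 1, the weight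
ħ^{n/2} absorbs l^{n/2}, and the whole packet has ℓ¹ norm at most D E^l (`sum_norm_truncated_le`).

Localization is a Chebyshev argument: where |x − a| > b one may insert (|x − a|/b)^{2l}. Applying l
position factors to a packet of order O(l) costs (const · ħ l / b²)^l in the squared norm, hence
(const · g)^l (`HasExpansion.setIntegral_norm_sq_le`). For small g this beats E^{2l} and leaves
exp(−2l). Because l = ⌊g/ħ⌋ ≥ g/(2ħ) once l ≥ 1, this is exponential decay in 1/ħ
(`pow_bound_le_exp`). The constants are uniform in ħ and t because the norm of the ground state is
(`norm_packetInner_one_le`). -/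

/-! ### Multi-indices and iterated operators -/

theorem order_zero : order (0 : MIdx d) = 0 := by simp [order]

theorem order_add_single (j : MIdx d) (m : Fin d) : order (j + Pi.single m 1) = order j + 1 := by
  simp [order, Finset.sum_add_distrib]

theorem exists_add_single (j : MIdx d) (m : Fin d) (h : j m ≠ 0) :
    ∃ i : MIdx d, j = i + Pi.single m 1 := by
  refine ⟨j - Pi.single m 1, ?_⟩
  ext n
  by_cases hn : n = m
  · subst hn; simp; omega
  · simp [hn]

theorem midx_induction {P : MIdx d → Prop} (h0 : P 0)
    (hs : ∀ j m, P j → P (j + Pi.single m 1)) (j : MIdx d) : P j := by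
  induction hk : order j generalizing j with
  | zero =>
    have : j = 0 := by
      ext n
      simp only [order, Finset.sum_eq_zero_iff] at hk
      exact hk n (Finset.mem_univ n)
    exact this ▸ h0
  | succ k ih =>
    have : ∃ m, j m ≠ 0 := by
      by_contra! hc
      simp [order, hc] at hk
    obtain ⟨m, hm⟩ := this
    obtain ⟨i, rfl⟩ := exists_add_single j m hm
    rw [order_add_single] at hk
    exact hs _ _ (ih i (by omega))

theorem mfact_add_single (j : MIdx d) (m : Fin d) :
    mfact (j + Pi.single m 1) = (j m + 1) * mfact j := by
  unfold mfact
  rw [← Finset.mul_prod_erase _ _ (Finset.mem_univ m),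
    ← Finset.mul_prod_erase (Finset.univ) (fun n => (j n).factorial) (Finset.mem_univ m)]
  have : ∀ n ∈ Finset.univ.erase m,
      ((j + Pi.single m 1 : MIdx d) n).factorial = (j n).factorial := by
    intro n hn
    simp [Finset.ne_of_mem_erase hn]
  rw [Finset.prod_congr rfl this]
  simp [Nat.factorial_succ, mul_assoc]

theorem mfact_pos (j : MIdx d) : 0 < mfact j := Finset.prod_pos fun _ _ => Nat.factorial_pos _

section iterOp

variable {F : Type*} (T : Fin d → F → F)

theorem foldr_iterate_congr (L : List (Fin d)) (i j : MIdx d) (f : F)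
    (h : ∀ n ∈ L, i n = j n) :
    L.foldr (fun n g => (T n)^[i n] g) f = L.foldr (fun n g => (T n)^[j n] g) f := by
  induction L with
  | nil => rfl
  | cons n L ih =>
    simp only [List.foldr_cons]
    rw [ih fun k hk => h k (List.mem_cons_of_mem _ hk), h n List.mem_cons_self]

theorem foldr_iterate_add_single (hT : ∀ m n, Function.Commute (T m) (T n)) (L : List (Fin d))
    (hL : L.Nodup) (m : Fin d) (hm : m ∈ L) (j : MIdx d) (f : F) :
    L.foldr (fun n g => (T n)^[(j + Pi.single m 1 : MIdx d) n] g) f =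
      T m (L.foldr (fun n g => (T n)^[j n] g) f) := by
  induction L with
  | nil => simp at hm
  | cons n L ih =>
    rw [List.nodup_cons] at hL
    simp only [List.foldr_cons]
    by_cases hmn : n = m
    · subst hmn
      rw [foldr_iterate_congr T L _ j]
      · simp [Function.iterate_succ_apply']
      · intro k hk
        have : k ≠ n := fun h => hL.1 (h ▸ hk)
        simp [this]
    · have hm' : m ∈ L := by simpa [Ne.symm hmn] using hm
      rw [ih hL.2 hm']
      have : (j + Pi.single m 1 : MIdx d) n = j n := by simp [hmn]
      rw [this]
      exact ((hT m n).iterate_right (j n) _).symm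

theorem iterOp_zero (f : F) : iterOp T 0 f = f := by
  simp [iterOp]

/-- `iterOp` composes in a fixed order of the indices, so a new factor can be brought to the front
only when the operators commute. -/
theorem iterOp_add_single (hT : ∀ m n, Function.Commute (T m) (T n)) (m : Fin d) (j : MIdx d)
    (f : F) : iterOp T (j + Pi.single m 1) f = T m (iterOp T j f) :=
  foldr_iterate_add_single T hT _ (List.nodup_finRange d) m (List.mem_finRange m) j f

/-- A map intertwining two families of operators intertwines their iterates. -/
theorem iterOp_semiconj {E : Type*} (T : Fin d → F → F) (T' : Fin d → E → E) (φ : E → F)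
    (h : ∀ m e, T m (φ e) = φ (T' m e)) (j : MIdx d) (e : E) :
    iterOp T j (φ e) = φ (iterOp T' j e) := by
  unfold iterOp
  generalize List.finRange d = L
  induction L with
  | nil => rfl
  | cons n L ih =>
    simp only [List.foldr_cons]
    rw [ih]
    exact (Function.Semiconj.iterate_right (f := φ) (ga := T' n) (gb := T n)
      (fun e => (h n e).symm) (j n) _).symm

end iterOp

/-! ### Creation and annihilation operators on polynomials -/

/-- Polynomials in `d` variables. -/
abbrev Poly (d : ℕ) := MvPolynomial (Fin d) ℂ

/-- The creation operator `X_m - ∑_k S_{km} ∂_k` on polynomials. -/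
def raisePoly (S : Matrix (Fin d) (Fin d) ℂ) (m : Fin d) : Poly d →ₗ[ℂ] Poly d :=
  LinearMap.mulLeft ℂ (MvPolynomial.X m) - ∑ k, S k m • (pderiv k).toLinearMap

theorem raisePoly_apply (S : Matrix (Fin d) (Fin d) ℂ) (m : Fin d) (P : Poly d) :
    raisePoly S m P = MvPolynomial.X m * P - ∑ k, S k m • pderiv k P := by
  simp [raisePoly]

theorem pderiv_pderiv_comm (m n : Fin d) (P : Poly d) :
    pderiv m (pderiv n P) = pderiv n (pderiv m P) := by
  have h : ⁅(pderiv m : Derivation ℂ (Poly d) (Poly d)), (pderiv n : Derivation ℂ (Poly d) (Poly d))⁆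
      = 0 := by
    apply MvPolynomial.derivation_ext
    intro i
    rw [Derivation.commutator_apply]
    simp only [MvPolynomial.pderiv_X, Derivation.zero_apply]
    rcases eq_or_ne i m with rfl | h1 <;> rcases eq_or_ne i n with rfl | h2 <;>
      simp [*]
  have := congrArg (fun D => D P) h
  simpa [Derivation.commutator_apply, sub_eq_zero] using this

/-- The canonical commutation relation [∂_m, R_n] = δ_{mn}: derivatives commute with each other, and
only the factor X_n contributes. -/
theorem pderiv_raisePoly (S : Matrix (Fin d) (Fin d) ℂ) (m n : Fin d) (P : Poly d) :
    pderiv m (raisePoly S n P) = raisePoly S n (pderiv m P) + if m = n then P else 0 := by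
  simp only [raisePoly_apply, map_sub, Derivation.leibniz, MvPolynomial.pderiv_X, map_sum,
    Derivation.map_smul, pderiv_pderiv_comm m]
  rcases eq_or_ne m n with rfl | h
  · simp; ring
  · simp [h, Ne.symm h]

/-- The commutator of R_m and R_n is the scalar S_{mn} − S_{nm}, so symmetry of S is exactly what is
needed. -/
theorem raisePoly_comm {S : Matrix (Fin d) (Fin d) ℂ} (hS : Sᵀ = S) (m n : Fin d) :
    Function.Commute (raisePoly S m) (raisePoly S n) := by
  intro P
  have h1 : ∀ m n, S m n = S n m := fun m n => by conv_lhs => rw [← hS, Matrix.transpose_apply]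
  have key : ∀ m n, raisePoly S m (raisePoly S n P) = MvPolynomial.X m * raisePoly S n P
      - ∑ k, S k m • raisePoly S n (pderiv k P) - S n m • P := by
    intro m n
    rw [raisePoly_apply]
    simp only [pderiv_raisePoly, smul_add, Finset.sum_add_distrib]
    simp
    ring
  rw [key, key, h1 n m]
  simp only [raisePoly_apply, smul_sub, Finset.sum_sub_distrib, mul_sub, Finset.mul_sum,
    Finset.smul_sum]
  have h2 : ∑ k, ∑ l, S k m • S l n • pderiv l (pderiv k P)
      = ∑ k, ∑ l, S k n • S l m • pderiv l (pderiv k P) := by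
    rw [Finset.sum_comm]
    refine Finset.sum_congr rfl fun k _ => Finset.sum_congr rfl fun l _ => ?_
    rw [pderiv_pderiv_comm, smul_comm]
  rw [h2]
  simp only [mul_smul_comm]
  ring

/-- The normalized states `(j!)^{-1/2} R^j 1`. -/
def hermPoly (S : Matrix (Fin d) (Fin d) ℂ) (j : MIdx d) : Poly d :=
  ((1 / Real.sqrt (mfact j) : ℝ) : ℂ) • iterOp (fun m => raisePoly S m) j 1

theorem hermPoly_zero (S : Matrix (Fin d) (Fin d) ℂ) : hermPoly S 0 = 1 := by
  simp [hermPoly, iterOp_zero, mfact]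

theorem raisePoly_hermPoly {S : Matrix (Fin d) (Fin d) ℂ} (hS : Sᵀ = S) (m : Fin d)
    (j : MIdx d) : raisePoly S m (hermPoly S j)
      = ((Real.sqrt (j m + 1) : ℝ) : ℂ) • hermPoly S (j + Pi.single m 1) := by
  unfold hermPoly
  rw [map_smul, iterOp_add_single _ (raisePoly_comm hS), smul_smul, mfact_add_single]
  congr 1
  norm_cast
  rw [Nat.cast_mul, Real.sqrt_mul (by positivity)]
  have h1 : Real.sqrt (j m + 1) ≠ 0 := by positivity
  have h2 : Real.sqrt (mfact j) ≠ 0 := by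
    have := mfact_pos j
    positivity
  push_cast
  field_simp

/-- Since ∂_n 1 = 0 and [∂_n, R_m] = δ_{nm}, the derivative ∂_n acts on R^j 1 as it does on the
monomial X^j. Treating j_n = 0 and j = i + e_n separately avoids truncated subtraction. -/
theorem pderiv_iterOp_raisePoly {S : Matrix (Fin d) (Fin d) ℂ} (hS : Sᵀ = S) (j : MIdx d) :
    ∀ n, (j n = 0 → pderiv n (iterOp (fun m => raisePoly S m) j (1 : Poly d)) = 0) ∧
      ∀ i, j = i + Pi.single n 1 → pderiv n (iterOp (fun m => raisePoly S m) j (1 : Poly d))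
        = ((i n + 1 : ℕ) : ℂ) • iterOp (fun m => raisePoly S m) i (1 : Poly d) := by
  have hc := raisePoly_comm hS
  induction j using midx_induction with
  | h0 =>
    intro n
    refine ⟨fun _ => by simp [iterOp_zero], fun i hi => ?_⟩
    have := congrFun hi n
    simp at this
  | hs j m ih =>
    intro n
    rw [iterOp_add_single _ hc, pderiv_raisePoly]
    by_cases hnm : n = m
    · subst hnm
      refine ⟨fun h => by simp at h, fun i hi => ?_⟩
      obtain rfl : j = i := add_right_cancel hi
      simp only [if_true]
      by_cases hj : j n = 0
      · rw [(ih n).1 hj, hj]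
        simp
      · obtain ⟨i, rfl⟩ := exists_add_single j n hj
        rw [(ih n).2 i rfl, map_smul, iterOp_add_single _ hc]
        simp [add_smul]
    · refine ⟨fun h => ?_, fun i hi => ?_⟩
      · have : j n = 0 := by simpa [hnm] using h
        simp [(ih n).1 this, hnm]
      · have him : i m ≠ 0 := by
          have := congrFun hi m
          simp [Ne.symm hnm] at this
          omega
        obtain ⟨i, rfl⟩ := exists_add_single i m him
        have hj : j = i + Pi.single n 1 := by
          rw [add_right_comm] at hi
          exact add_right_cancel hi
        rw [(ih n).2 i hj, map_smul, iterOp_add_single _ hc]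
        simp [hnm]

theorem pderiv_hermPoly_of_eq_zero {S : Matrix (Fin d) (Fin d) ℂ} (hS : Sᵀ = S) (n : Fin d)
    (j : MIdx d) (h : j n = 0) : pderiv n (hermPoly S j) = 0 := by
  unfold hermPoly
  rw [Derivation.map_smul, (pderiv_iterOp_raisePoly hS j n).1 h, smul_zero]

theorem pderiv_hermPoly_add_single {S : Matrix (Fin d) (Fin d) ℂ} (hS : Sᵀ = S) (m : Fin d)
    (j : MIdx d) : pderiv m (hermPoly S (j + Pi.single m 1))
      = ((Real.sqrt (j m + 1) : ℝ) : ℂ) • hermPoly S j := by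
  unfold hermPoly
  rw [Derivation.map_smul, (pderiv_iterOp_raisePoly hS _ m).2 j rfl, smul_smul, smul_smul,
    mfact_add_single]
  congr 1
  norm_cast
  rw [Nat.cast_mul, Real.sqrt_mul (by positivity)]
  have h1 : Real.sqrt (j m + 1) ≠ 0 := by positivity
  have h2 : Real.sqrt (mfact j) ≠ 0 := by
    have := mfact_pos j
    positivity
  have h3 : Real.sqrt (j m + 1) ^ 2 = j m + 1 := Real.sq_sqrt (by positivity)
  push_cast
  field_simp
  rw [h3]

/-! ### Finite expansions with an `ℓ¹` bound -/

/-- `P` is a combination of the states of order at most `N`, the coefficients having `ℓ¹` norm at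
most `C`. -/
def HasExpansion (S : Matrix (Fin d) (Fin d) ℂ) (P : Poly d) (N : ℕ) (C : ℝ) : Prop :=
  ∃ c : MIdx d → ℂ, P = ∑ j ∈ idxLe d N, c j • hermPoly S j ∧ ∑ j ∈ idxLe d N, ‖c j‖ ≤ C

namespace HasExpansion

variable {S : Matrix (Fin d) (Fin d) ℂ} {P Q : Poly d} {N N' : ℕ} {C C' : ℝ}

theorem nonneg (h : HasExpansion S P N C) : 0 ≤ C := by
  obtain ⟨c, -, h⟩ := h
  exact (Finset.sum_nonneg fun _ _ => norm_nonneg _).trans h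

theorem mono (h : HasExpansion S P N C) (hN : N ≤ N') (hC : C ≤ C') : HasExpansion S P N' C' := by
  obtain ⟨c, rfl, h⟩ := h
  have hsub : idxLe d N ⊆ idxLe d N' := fun j hj => by
    rw [mem_idxLe] at *
    omega
  refine ⟨fun j => if j ∈ idxLe d N then c j else 0, ?_, ?_⟩
  · rw [← Finset.sum_subset hsub]
    · exact Finset.sum_congr rfl fun j hj => by simp [hj]
    · intro j _ hj
      simp [hj]
  · refine le_trans (le_of_eq ?_) (h.trans hC)
    rw [← Finset.sum_subset hsub]
    · exact Finset.sum_congr rfl fun j hj => by simp [hj]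
    · intro j _ hj
      simp [hj]

theorem zero (N : ℕ) : HasExpansion S (0 : Poly d) N 0 := ⟨0, by simp, by simp⟩

theorem hermPoly (j : MIdx d) : HasExpansion S (hermPoly S j) (order j) 1 := by
  classical
  have hj : j ∈ idxLe d (order j) := mem_idxLe.2 le_rfl
  refine ⟨Pi.single j 1, ?_, ?_⟩
  · rw [Finset.sum_eq_single_of_mem j hj]
    · simp
    · intro i _ hi
      simp [hi]
  · rw [Finset.sum_eq_single_of_mem j hj]
    · simp
    · intro i _ hi
      simp [hi]

theorem add (hP : HasExpansion S P N C) (hQ : HasExpansion S Q N C') :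
    HasExpansion S (P + Q) N (C + C') := by
  obtain ⟨c, rfl, h⟩ := hP
  obtain ⟨c', rfl, h'⟩ := hQ
  refine ⟨c + c', by simp [add_smul, Finset.sum_add_distrib], ?_⟩
  refine le_trans (Finset.sum_le_sum fun j _ => norm_add_le (c j) (c' j)) ?_
  rw [Finset.sum_add_distrib]
  exact add_le_add h h'

theorem smul (hP : HasExpansion S P N C) (z : ℂ) : HasExpansion S (z • P) N (‖z‖ * C) := by
  obtain ⟨c, rfl, h⟩ := hP
  refine ⟨z • c, by simp [Finset.smul_sum, smul_smul], ?_⟩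
  simp only [Pi.smul_apply, smul_eq_mul, norm_mul, ← Finset.mul_sum]
  exact mul_le_mul_of_nonneg_left h (norm_nonneg _)

theorem sum {ι : Type*} (s : Finset ι) (f : ι → Poly d) (C : ι → ℝ)
    (h : ∀ i ∈ s, HasExpansion S (f i) N (C i)) :
    HasExpansion S (∑ i ∈ s, f i) N (∑ i ∈ s, C i) := by
  classical
  induction s using Finset.induction_on with
  | empty => simpa using zero N
  | insert a s ha ih =>
    rw [Finset.sum_insert ha, Finset.sum_insert ha]
    exact (h a (Finset.mem_insert_self _ _)).add
      (ih fun i hi => h i (Finset.mem_insert_of_mem hi))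

/-- The reason for measuring coefficients in ℓ¹: an operator is bounded by its worst value on a
single basis state, without any use of orthogonality. -/
theorem map (f : Poly d →ₗ[ℂ] Poly d)
    (hf : ∀ j, order j ≤ N → HasExpansion S (f (SemiclassicalPacket.hermPoly S j)) N' C')
    (hC' : 0 ≤ C') (hP : HasExpansion S P N C) : HasExpansion S (f P) N' (C' * C) := by
  obtain ⟨c, rfl, h⟩ := hP
  rw [map_sum]
  simp only [map_smul]
  refine (sum _ _ _ fun j hj => (hf j (mem_idxLe.1 hj)).smul (c j)).mono le_rfl ?_
  rw [← Finset.sum_mul, mul_comm]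
  exact mul_le_mul_of_nonneg_left h hC'

theorem raise (hS : Sᵀ = S) (m : Fin d) (hP : HasExpansion S P N C) :
    HasExpansion S (raisePoly S m P) (N + 1) (Real.sqrt (N + 1) * C) := by
  refine hP.map _ (fun j hj => ?_) (Real.sqrt_nonneg _)
  rw [raisePoly_hermPoly hS]
  refine ((hermPoly _).smul _).mono ?_ ?_
  · rw [order_add_single]
    omega
  · rw [mul_one, Complex.norm_real, Real.norm_of_nonneg (Real.sqrt_nonneg _)]
    apply Real.sqrt_le_sqrt
    have : j m ≤ order j := Finset.single_le_sum (fun _ _ => Nat.zero_le _) (Finset.mem_univ m)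
    have : j m ≤ N := this.trans hj
    exact_mod_cast Nat.succ_le_succ this

/-- Differentiation lowers the order; the weaker parameters N + 1 and √(N + 1) are those of `raise`,
so that the two can be added. -/
theorem pderiv (hS : Sᵀ = S) (m : Fin d) (hP : HasExpansion S P N C) :
    HasExpansion S (MvPolynomial.pderiv m P) (N + 1) (Real.sqrt (N + 1) * C) := by
  refine hP.map (MvPolynomial.pderiv m).toLinearMap (fun j hj => ?_) (Real.sqrt_nonneg _)
  change HasExpansion S (MvPolynomial.pderiv m (SemiclassicalPacket.hermPoly S j)) _ _
  by_cases hj0 : j m = 0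
  · rw [pderiv_hermPoly_of_eq_zero hS m j hj0]
    exact (zero _).mono le_rfl (Real.sqrt_nonneg _)
  · obtain ⟨i, rfl⟩ := exists_add_single j m hj0
    rw [order_add_single] at hj
    rw [pderiv_hermPoly_add_single hS]
    refine ((hermPoly _).smul _).mono (by omega) ?_
    rw [mul_one, Complex.norm_real, Real.norm_of_nonneg (Real.sqrt_nonneg _)]
    apply Real.sqrt_le_sqrt
    have : i m ≤ order i := Finset.single_le_sum (fun _ _ => Nat.zero_le _) (Finset.mem_univ m)
    have : i m ≤ N := by omega
    exact_mod_cast Nat.succ_le_succ this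

end HasExpansion

/-! ### Multiplication by the position in the basis of states -/

/-- The polynomial in the complex coordinates that represents the rescaled position
`(x_n - a_n) / √ħ`. -/
def posPoly (A : Matrix (Fin d) (Fin d) ℂ) (n : Fin d) : Poly d :=
  ((1 / Real.sqrt 2 : ℝ) : ℂ) • ∑ k, A n k • MvPolynomial.X k

/-- Substituting X_k = R_k + ∑_l S_{lk} ∂_l in ∑_k A_{nk} X_k and using A S = conj(A) gives ∑_k
(A_{nk} R_k + conj(A_{nk}) ∂_k). Each of these 2d terms costs at most K √(N + 1), and the factor
1/√2 is bounded by 1. -/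
theorem HasExpansion.posPoly_mul {A S : Matrix (Fin d) (Fin d) ℂ} {P : Poly d} {N : ℕ} {C K : ℝ}
    (hS : Sᵀ = S) (hAS : A * S = A.map conj) (hK : ∀ i j, ‖A i j‖ ≤ K) (n : Fin d)
    (hP : HasExpansion S P N C) :
    HasExpansion S (posPoly A n * P) (N + 1) (2 * d * K * Real.sqrt (N + 1) * C) := by
  have hC := hP.nonneg
  have hAS' : ∀ l, ∑ k, A n k * S l k = conj (A n l) := fun l => by
    have := congrFun (congrFun hAS n) l
    rw [Matrix.mul_apply] at this
    rw [← Matrix.map_apply (f := conj) (M := A), ← this]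
    refine Finset.sum_congr rfl fun k _ => ?_
    conv_lhs => rw [← hS, Matrix.transpose_apply]
  have h1 : posPoly A n * P = ((1 / Real.sqrt 2 : ℝ) : ℂ) •
      (∑ k, A n k • raisePoly S k P + ∑ k, conj (A n k) • MvPolynomial.pderiv k P) := by
    unfold posPoly
    rw [smul_mul_assoc]
    congr 1
    simp only [raisePoly_apply, smul_sub, Finset.sum_sub_distrib, Finset.sum_mul, smul_mul_assoc,
      Finset.smul_sum, smul_smul]
    rw [eq_comm, sub_add_eq_add_sub, sub_eq_iff_eq_add, add_right_inj, Finset.sum_comm]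
    refine Finset.sum_congr rfl fun l _ => ?_
    rw [← Finset.sum_smul, hAS']
  rw [h1]
  refine (((HasExpansion.sum _ _ _ fun k _ => (hP.raise hS k).smul (A n k)).add
    (HasExpansion.sum _ _ _ fun k _ => (hP.pderiv hS k).smul (conj (A n k)))).smul _).mono
    le_rfl ?_
  have h2 : ‖((1 / Real.sqrt 2 : ℝ) : ℂ)‖ ≤ 1 := by
    rw [Complex.norm_real, Real.norm_of_nonneg (by positivity), div_le_one (by positivity)]
    exact Real.one_le_sqrt.2 (by norm_num)
  have h3 : ∑ k, ‖A n k‖ * (Real.sqrt (N + 1) * C) ≤ d * (K * (Real.sqrt (N + 1) * C)) := by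
    refine (Finset.sum_le_card_nsmul _ _ _ fun k _ =>
      mul_le_mul_of_nonneg_right (hK n k) (by positivity)).trans ?_
    simp
  simp only [RCLike.norm_conj]
  calc _ ≤ 1 * (∑ k, ‖A n k‖ * (Real.sqrt (N + 1) * C)
        + ∑ k, ‖A n k‖ * (Real.sqrt (N + 1) * C)) :=
        mul_le_mul_of_nonneg_right h2 (add_nonneg
          (Finset.sum_nonneg fun _ _ => by positivity) (Finset.sum_nonneg fun _ _ => by positivity))
    _ ≤ _ := by linarith

/-- The order grows by one with each position factor, so the square root met at the last factor, √(N
+ |m|), bounds all of them. -/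
theorem HasExpansion.prod_posPoly_mul {A S : Matrix (Fin d) (Fin d) ℂ} {P : Poly d} {N : ℕ}
    {C K : ℝ} (hS : Sᵀ = S) (hAS : A * S = A.map conj) (hK : ∀ i j, ‖A i j‖ ≤ K) (hK0 : 0 ≤ K)
    (hP : HasExpansion S P N C) (m : MIdx d) :
    HasExpansion S ((∏ n, posPoly A n ^ m n) * P) (N + order m)
      ((2 * d * K * Real.sqrt (N + order m)) ^ order m * C) := by
  have hC := hP.nonneg
  induction m using midx_induction with
  | h0 => simpa [order_zero] using hP
  | hs m k ih =>
    have h1 : (∏ n, posPoly A n ^ (m + Pi.single k 1 : MIdx d) n) * P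
        = posPoly A k * ((∏ n, posPoly A n ^ m n) * P) := by
      simp only [Pi.add_apply, pow_add, Finset.prod_mul_distrib]
      rw [Finset.prod_eq_single_of_mem (f := fun n => posPoly A n ^ (Pi.single k 1 : MIdx d) n) k
        (Finset.mem_univ k)]
      · simp; ring
      · intro n _ hn
        simp [hn]
    rw [h1, order_add_single, ← add_assoc]
    refine (ih.posPoly_mul hS hAS hK k).mono le_rfl ?_
    rw [pow_succ', mul_assoc _ _ C]
    push_cast
    have h2 : Real.sqrt (N + order m) ≤ Real.sqrt (N + (order m + 1)) :=
      Real.sqrt_le_sqrt (by linarith)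
    rw [add_assoc]
    gcongr

/-! ### Symmetry of A⁻¹ conj(A) -/

/-- The symmetric unitary matrix `A⁻¹ conj(A)`. -/
def shearMat (A : Matrix (Fin d) (Fin d) ℂ) : Matrix (Fin d) (Fin d) ℂ := A⁻¹ * A.map conj

namespace Admissible

variable {A B : Matrix (Fin d) (Fin d) ℂ}

theorem inv_mul (hp : Admissible A B) : A⁻¹ * A = 1 := Matrix.nonsing_inv_mul _ hp.unit_A
theorem mul_inv (hp : Admissible A B) : A * A⁻¹ = 1 := Matrix.mul_nonsing_inv _ hp.unit_A

theorem mul_shearMat (hp : Admissible A B) : A * shearMat A = A.map conj := by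
  rw [shearMat, ← Matrix.mul_assoc, hp.mul_inv, Matrix.one_mul]

/-- Write S = A⁻¹ conj(A). The transposed relations give B S + conj(B) = 2 (A⁻¹)ᵗ. Multiplied on the
left by A^*, the left side becomes 2S: A^*B S = 2S − B^* conj(A), and A^* conj(B) = B^* conj(A).
Hence S = A^*(A⁻¹)ᵗ, which is Sᵗ. -/
theorem shearMat_symm (hp : Admissible A B) : (shearMat A)ᵀ = shearMat A := by
  set Ac := A.map conj with hAc
  set Bc := B.map conj with hBc
  have hAcH : Acᵀ = Aᴴ := rfl
  have hBcH : Bcᵀ = Bᴴ := rfl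
  have hAt : (A⁻¹)ᵀ * Aᵀ = 1 := by rw [← Matrix.transpose_mul, hp.mul_inv, Matrix.transpose_one]
  have h2 : Aᵀ * B = Bᵀ * A := sub_eq_zero.1 hp.symm
  have h3 : Aᴴ * Bc = Bᴴ * Ac := by
    have := congrArg (fun M : Matrix (Fin d) (Fin d) ℂ => M.map conj) h2
    rw [Matrix.map_mul, Matrix.map_mul, Matrix.transpose_map, Matrix.transpose_map] at this
    exact this
  have h1 : Bᵀ * Ac + Aᵀ * Bc = (2 : ℂ) • (1 : Matrix (Fin d) (Fin d) ℂ) := by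
    have := congrArg Matrix.transpose hp.herm
    rw [Matrix.transpose_add, Matrix.transpose_mul, Matrix.transpose_mul, ← hAcH, ← hBcH,
      Matrix.transpose_transpose, Matrix.transpose_transpose, Matrix.transpose_smul,
      Matrix.transpose_one] at this
    exact this
  have h4 : B * shearMat A + Bc = (2 : ℂ) • (A⁻¹)ᵀ := by
    have : Aᵀ * (B * shearMat A + Bc) = (2 : ℂ) • (1 : Matrix (Fin d) (Fin d) ℂ) := by
      rw [Matrix.mul_add, ← Matrix.mul_assoc, h2, Matrix.mul_assoc, hp.mul_shearMat, h1]
    calc B * shearMat A + Bc = (A⁻¹)ᵀ * Aᵀ * (B * shearMat A + Bc) := by rw [hAt, Matrix.one_mul]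
      _ = _ := by rw [Matrix.mul_assoc, this]; simp
  have h5 : Aᴴ * B = (2 : ℂ) • (1 : Matrix (Fin d) (Fin d) ℂ) - Bᴴ * A := eq_sub_of_add_eq hp.herm
  have h6 : (2 : ℂ) • shearMat A = (2 : ℂ) • (Aᴴ * (A⁻¹)ᵀ) := by
    calc (2 : ℂ) • shearMat A = Aᴴ * (B * shearMat A + Bc) := by
          rw [Matrix.mul_add, ← Matrix.mul_assoc, h5, Matrix.sub_mul, Matrix.mul_assoc Bᴴ,
            hp.mul_shearMat, h3]
          simp [hAc]
      _ = _ := by rw [h4]; simp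
  have h7 : shearMat A = Aᴴ * (A⁻¹)ᵀ := smul_right_injective _ (two_ne_zero' ℂ) h6
  conv_lhs => rw [shearMat, Matrix.transpose_mul]
  rw [h7]
  rfl

end Admissible

/-! ### Polynomials times the Gaussian and their derivatives -/

/-- The displacement `x - a`. -/
def disp (p : PacketData d) (x : Conf d) : Fin d → ℂ := fun n => ((x n - p.a n : ℝ) : ℂ)

/-- The complex coordinates `√(2/ħ) A⁻¹ (x - a)`. -/
def cplxCoord (p : PacketData d) (h : ℝ) (x : Conf d) : Fin d → ℂ :=
  ((Real.sqrt (2 / h) : ℝ) : ℂ) • (p.A⁻¹ *ᵥ disp p x)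

/-- The `n`-th coordinate as a complex-valued functional. -/
def coordFun (n : Fin d) : Conf d →L[ℝ] ℂ :=
  Complex.ofRealCLM ∘L (EuclideanSpace.proj n : Conf d →L[ℝ] ℝ)

theorem coordFun_apply (n : Fin d) (v : Conf d) : coordFun n v = (v n : ℂ) := rfl

theorem coordFun_single (n k : Fin d) :
    coordFun n (EuclideanSpace.single k 1) = if n = k then 1 else 0 := by
  rw [coordFun_apply]
  by_cases h : n = k
  · subst h; simp
  · simp [h]

/-- The derivative of the `k`-th complex coordinate. -/
def cplxCoordDeriv (p : PacketData d) (h : ℝ) (k : Fin d) : Conf d →L[ℝ] ℂ :=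
  ((Real.sqrt (2 / h) : ℝ) : ℂ) • ∑ n, p.A⁻¹ k n •
    coordFun n

theorem cplxCoordDeriv_single (p : PacketData d) (h : ℝ) (k n : Fin d) :
    cplxCoordDeriv p h k (EuclideanSpace.single n 1)
      = ((Real.sqrt (2 / h) : ℝ) : ℂ) * p.A⁻¹ k n := by
  simp [cplxCoordDeriv, coordFun_single]

theorem hasFDerivAt_cplxCoord (p : PacketData d) (h : ℝ) (k : Fin d) (x : Conf d) :
    HasFDerivAt (fun x => cplxCoord p h x k) (cplxCoordDeriv p h k) x := by
  have h1 : (fun x => cplxCoord p h x k) = fun x => cplxCoordDeriv p h k (x - p.a) := by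
    ext x
    simp [cplxCoord, cplxCoordDeriv, disp, coordFun_apply, Matrix.mulVec, dotProduct]
  rw [h1]
  exact (cplxCoordDeriv p h k).hasFDerivAt.comp x ((hasFDerivAt_id x).sub_const _)

theorem hasFDerivAt_eval (p : PacketData d) (h : ℝ) (P : Poly d) (x : Conf d) :
    HasFDerivAt (fun x => MvPolynomial.eval (cplxCoord p h x) P)
      (∑ k, MvPolynomial.eval (cplxCoord p h x) (pderiv k P) • cplxCoordDeriv p h k) x := by
  induction P using MvPolynomial.induction_on with
  | C z =>
    simp only [MvPolynomial.eval_C]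
    refine (hasFDerivAt_const (𝕜 := ℝ) z x).congr_fderiv (ContinuousLinearMap.ext fun v => ?_)
    simp
  | add P Q hP hQ =>
    simp only [map_add]
    refine (hP.fun_add hQ).congr_fderiv ?_
    ext v
    simp [add_mul, Finset.sum_add_distrib]
  | mul_X P n hP =>
    simp only [map_mul, MvPolynomial.eval_X]
    refine (hP.fun_mul (hasFDerivAt_cplxCoord p h n x)).congr_fderiv ?_
    ext v
    simp [Derivation.leibniz, MvPolynomial.pderiv_X, add_mul, Finset.sum_add_distrib,
      Finset.mul_sum, mul_assoc, Pi.single_apply, apply_ite, ite_mul]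

theorem mulVec_cplxCoord {p : PacketData d} (hp : Admissible p.A p.B) (h : ℝ) (x : Conf d) : p.A *ᵥ cplxCoord p h x = ((Real.sqrt (2 / h) : ℝ) : ℂ) • disp p x := by
  rw [cplxCoord, Matrix.mulVec_smul, Matrix.mulVec_mulVec, hp.mul_inv, Matrix.one_mulVec]

theorem disp_eq {p : PacketData d} (hp : Admissible p.A p.B) {h : ℝ} (hh : 0 < h)
    (x : Conf d) : disp p x = ((Real.sqrt (h / 2) : ℝ) : ℂ) • (p.A *ᵥ cplxCoord p h x) := by
  rw [mulVec_cplxCoord hp h, smul_smul, ← Complex.ofReal_mul,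
    ← Real.sqrt_mul (by positivity)]
  field_simp
  simp

theorem eval_posPoly {p : PacketData d} (hp : Admissible p.A p.B) {h : ℝ} (hh : 0 < h)
    (x : Conf d) (n : Fin d) :
    MvPolynomial.eval (cplxCoord p h x) (posPoly p.A n)
      = (((x n - p.a n) / Real.sqrt h : ℝ) : ℂ) := by
  have h1 := congrFun (mulVec_cplxCoord hp h x) n
  have h2 : MvPolynomial.eval (cplxCoord p h x) (posPoly p.A n)
      = ((1 / Real.sqrt 2 : ℝ) : ℂ) * (p.A *ᵥ cplxCoord p h x) n := by
    simp [posPoly, Matrix.mulVec, dotProduct, MvPolynomial.smul_eval]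
  rw [h2, h1]
  simp only [disp, Pi.smul_apply, smul_eq_mul, ← Complex.ofReal_mul]
  congr 1
  rw [Real.sqrt_div (by norm_num)]
  field_simp

/-- The polynomial times Gaussian `P(√(2/ħ) A⁻¹ (x - a)) φ_0(x)`. -/
def polyPacket (p : PacketData d) (h : ℝ) (P : Poly d) (x : Conf d) : ℂ :=
  MvPolynomial.eval (cplxCoord p h x) P * phiZero p h x

section linear
variable (p : PacketData d) (h : ℝ)

theorem polyPacket_add (P Q : Poly d) :
    polyPacket p h (P + Q) = polyPacket p h P + polyPacket p h Q := by
  ext x; simp [polyPacket, add_mul]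

theorem polyPacket_sub (P Q : Poly d) :
    polyPacket p h (P - Q) = polyPacket p h P - polyPacket p h Q := by
  ext x; simp [polyPacket, sub_mul]

theorem polyPacket_smul (z : ℂ) (P : Poly d) :
    polyPacket p h (z • P) = z • polyPacket p h P := by
  ext x; simp [polyPacket, MvPolynomial.smul_eval, mul_assoc]

theorem polyPacket_sum {ι : Type*} (s : Finset ι) (f : ι → Poly d) (x : Conf d) :
    polyPacket p h (∑ i ∈ s, f i) x = ∑ i ∈ s, polyPacket p h (f i) x := by
  simp [polyPacket, Finset.sum_mul]

theorem polyPacket_mul (P Q : Poly d) (x : Conf d) :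
    polyPacket p h (P * Q) x = MvPolynomial.eval (cplxCoord p h x) P * polyPacket p h Q x := by
  simp [polyPacket, mul_assoc]

theorem polyPacket_one : polyPacket p h 1 = phiZero p h := by
  ext x; simp [polyPacket]

end linear

theorem hasFDerivAt_phiZero (p : PacketData d) (hp : Admissible p.A p.B) (h : ℝ) (x : Conf d) :
    HasFDerivAt (phiZero p h) (phiZero p h x • ∑ n,
      (-((p.B * p.A⁻¹) *ᵥ disp p x) n / h + Complex.I * p.η n / h) •
        coordFun n) x := by
  have hd : ∀ n, HasFDerivAt (fun x => disp p x n)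
      (coordFun n) x := fun n => by
    have h1 : (fun x => disp p x n) = fun x =>
        coordFun n (x - p.a) := by
      ext x; simp [disp, coordFun_apply]
    rw [h1]
    exact (ContinuousLinearMap.hasFDerivAt _).comp x ((hasFDerivAt_id x).sub_const _)
  -- The relation AᵗB = BᵗA makes B A⁻¹ symmetric, so the gradient of the quadratic form is 2 B
  -- A⁻¹(x − a).
  set Q := p.B * p.A⁻¹ with hQ
  have hQs : ∀ i j, Q i j = Q j i := by
    have h2 : p.Aᵀ * p.B = p.Bᵀ * p.A := sub_eq_zero.1 hp.symm
    have hAt : (p.A⁻¹)ᵀ * p.Aᵀ = 1 := by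
      rw [← Matrix.transpose_mul, hp.mul_inv, Matrix.transpose_one]
    have : Qᵀ = Q := by
      calc Qᵀ = (p.A⁻¹)ᵀ * (p.Bᵀ * p.A) * p.A⁻¹ := by
            rw [hQ, Matrix.transpose_mul, Matrix.mul_assoc, Matrix.mul_assoc, hp.mul_inv,
              Matrix.mul_one]
        _ = Q := by rw [← h2, ← Matrix.mul_assoc, hAt, Matrix.one_mul]
    intro i j
    conv_lhs => rw [← this, Matrix.transpose_apply]
  have hE : HasFDerivAt (fun x => -(disp p x ⬝ᵥ (Q *ᵥ disp p x)) / (2 * (h : ℂ))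
      + Complex.I * ((fun n => ((p.η n : ℝ) : ℂ)) ⬝ᵥ disp p x) / (h : ℂ)) (∑ n,
      (-(Q *ᵥ disp p x) n / h + Complex.I * p.η n / h) •
        coordFun n) x := by
    have h1 : HasFDerivAt (fun x => disp p x ⬝ᵥ (Q *ᵥ disp p x)) (∑ n,
      (2 * (Q *ᵥ disp p x) n) •
        coordFun n) x := by
      simp only [dotProduct, Matrix.mulVec]
      refine (HasFDerivAt.fun_sum (u := (Finset.univ : Finset (Fin d))) fun n _ => (hd n).fun_mul
        (HasFDerivAt.fun_sum (u := (Finset.univ : Finset (Fin d))) fun k _ =>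
          (hd k).const_mul (Q n k))).congr_fderiv ?_
      ext v
      have h3 : ∑ n, disp p x n * ∑ k, Q n k * (v k : ℂ)
          = ∑ n, (∑ k, Q n k * disp p x k) * (v n : ℂ) := by
        simp only [Finset.mul_sum, Finset.sum_mul]
        rw [Finset.sum_comm]
        refine Finset.sum_congr rfl fun k _ => Finset.sum_congr rfl fun n _ => ?_
        rw [hQs]
        ring
      have h4 : ∑ n, 2 * (∑ k, Q n k * disp p x k) * (v n : ℂ)
          = ∑ n, disp p x n * ∑ k, Q n k * (v k : ℂ)
            + ∑ n, (∑ k, Q n k * disp p x k) * (v n : ℂ) := by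
        rw [h3, ← two_mul, Finset.mul_sum]
        simp only [mul_assoc]
      simpa [coordFun_apply, Finset.sum_add_distrib] using h4.symm
    have h2 : HasFDerivAt (fun x => (fun n => ((p.η n : ℝ) : ℂ)) ⬝ᵥ disp p x) (∑ n,
      ((p.η n : ℝ) : ℂ) •
        coordFun n) x := by
      simp only [dotProduct]
      exact HasFDerivAt.fun_sum (u := (Finset.univ : Finset (Fin d))) fun k _ => (hd k).const_mul _
    refine (((h1.const_mul (-1 / (2 * (h : ℂ)))).fun_add
      (h2.const_mul (Complex.I / h))).congr_of_eventuallyEq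
        (Filter.Eventually.of_forall fun x => ?_)).congr_fderiv ?_
    · ring
    · ext v
      simp only [_root_.add_apply, _root_.smul_apply,
        _root_.sum_apply, smul_eq_mul, Finset.mul_sum, ← Finset.sum_add_distrib]
      refine Finset.sum_congr rfl fun n _ => ?_
      by_cases hh : (h : ℂ) = 0
      · simp [hh]
      · field_simp
  have := (hE.cexp).const_mul
    (((Real.pi ^ (-(d : ℝ) / 4) * h ^ (-(d : ℝ) / 4) : ℝ) : ℂ) * p.rootDet⁻¹)
  rw [smul_smul] at this
  exact this

theorem hasFDerivAt_polyPacket (p : PacketData d) (hp : Admissible p.A p.B) (h : ℝ) (P : Poly d)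
    (x : Conf d) : ∃ D : Conf d →L[ℝ] ℂ, HasFDerivAt (polyPacket p h P) D x ∧
      ∀ n, D (EuclideanSpace.single n 1) = ((Real.sqrt (2 / h) : ℝ) : ℂ) *
        ∑ k, p.A⁻¹ k n * polyPacket p h (pderiv k P) x +
        (-((p.B * p.A⁻¹) *ᵥ disp p x) n / h + Complex.I * p.η n / h) * polyPacket p h P x := by
  refine ⟨_, (hasFDerivAt_eval p h P x).mul (hasFDerivAt_phiZero p hp h x), fun n => ?_⟩
  simp [cplxCoordDeriv_single, coordFun_single, polyPacket, Finset.mul_sum]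
  rw [add_comm]
  congr 1
  · exact Finset.sum_congr rfl fun k _ => by ring
  · ring

theorem differentiable_polyPacket {p : PacketData d} (hp : Admissible p.A p.B) (h : ℝ)
    (P : Poly d) : Differentiable ℝ (polyPacket p h P) := fun x => by
  obtain ⟨D, hD, -⟩ := hasFDerivAt_polyPacket p hp h P x
  exact hD.differentiableAt

/-- The action of `-ħ ∂_n + i η_n` on polynomials times the Gaussian. -/
theorem momentum_polyPacket {p : PacketData d} (hp : Admissible p.A p.B) {h : ℝ} (hh : 0 < h)
    (P : Poly d) (n : Fin d) (x : Conf d) :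
    -(h : ℂ) * partialD n (polyPacket p h P) x + Complex.I * p.η n * polyPacket p h P x
      = -((Real.sqrt (2 * h) : ℝ) : ℂ) * ∑ k, p.A⁻¹ k n * polyPacket p h (pderiv k P) x
        + ((Real.sqrt (h / 2) : ℝ) : ℂ) * (p.B *ᵥ cplxCoord p h x) n * polyPacket p h P x := by
  obtain ⟨D, hD, h1⟩ := hasFDerivAt_polyPacket p hp h P x
  have hh' : (h : ℂ) ≠ 0 := by exact_mod_cast hh.ne'
  rw [partialD, hD.fderiv, h1]
  have h2 : (p.B * p.A⁻¹) *ᵥ disp p x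
      = ((Real.sqrt (h / 2) : ℝ) : ℂ) • (p.B *ᵥ cplxCoord p h x) := by
    rw [disp_eq hp hh, Matrix.mulVec_smul, Matrix.mulVec_mulVec, Matrix.mul_assoc, hp.inv_mul,
      Matrix.mul_one]
  have h3 : (h : ℂ) * ((Real.sqrt (2 / h) : ℝ) : ℂ) = ((Real.sqrt (2 * h) : ℝ) : ℂ) := by
    norm_cast
    rw [← Real.sqrt_sq hh.le, ← Real.sqrt_mul (by positivity), Real.sqrt_sq hh.le]
    congr 1
    field_simp
  rw [h2, ← h3]
  simp only [Pi.smul_apply, smul_eq_mul]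
  field_simp
  ring

theorem sum_conj_mul_mulVec (M N : Matrix (Fin d) (Fin d) ℂ) (m : Fin d) (w : Fin d → ℂ) :
    ∑ n, conj (M n m) * (N *ᵥ w) n = ((Mᴴ * N) *ᵥ w) m := by
  rw [← Matrix.mulVec_mulVec]
  simp [Matrix.mulVec, dotProduct, Matrix.conjTranspose_apply]

theorem sum_mul_mulVec (M N : Matrix (Fin d) (Fin d) ℂ) (m : Fin d) (w : Fin d → ℂ) :
    ∑ n, M n m * (N *ᵥ w) n = ((Mᵀ * N) *ᵥ w) m := by
  rw [← Matrix.mulVec_mulVec]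
  simp [Matrix.mulVec, dotProduct, Matrix.transpose_apply]

theorem raising_polyPacket {p : PacketData d} (hp : Admissible p.A p.B) {h : ℝ} (hh : 0 < h)
    (m : Fin d) (P : Poly d) :
    raising p h m (polyPacket p h P) = polyPacket p h (raisePoly (shearMat p.A) m P) := by
  ext x
  set g := polyPacket p h P x with hg
  have h1 : ∀ n, ((x n - p.a n : ℝ) : ℂ)
      = ((Real.sqrt (h / 2) : ℝ) : ℂ) * (p.A *ᵥ cplxCoord p h x) n := fun n => by
    have := congrFun (disp_eq hp hh x) n
    simpa [disp] using this
  have h2 : raising p h m (polyPacket p h P) x = ((1 / Real.sqrt (2 * h) : ℝ) : ℂ) *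
      (∑ n, conj (p.B n m) * ((x n - p.a n : ℝ) : ℂ) * g + ∑ n, conj (p.A n m) *
        (-(h : ℂ) * partialD n (polyPacket p h P) x + Complex.I * p.η n * g)) := by
    simp only [raising, ← hg]
    congr 1
    rw [sub_eq_add_neg, Finset.mul_sum, ← Finset.sum_neg_distrib]
    congr 1
    refine Finset.sum_congr rfl fun n _ => ?_
    linear_combination (conj (p.A n m)) * (h : ℂ) * partialD n (polyPacket p h P) x
      * Complex.I_sq
  have hmom : ∀ n, -(h : ℂ) * partialD n (polyPacket p h P) x + Complex.I * p.η n * g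
      = -((Real.sqrt (2 * h) : ℝ) : ℂ) * ∑ k, p.A⁻¹ k n * polyPacket p h (pderiv k P) x
        + ((Real.sqrt (h / 2) : ℝ) : ℂ) * (p.B *ᵥ cplxCoord p h x) n * g :=
    fun n => momentum_polyPacket hp hh P n x
  rw [h2]
  simp only [hmom, h1]
  rw [raisePoly_apply, polyPacket_sub, Pi.sub_apply, polyPacket_mul, polyPacket_sum,
    MvPolynomial.eval_X, ← hg]
  have h3 : ∑ n, conj (p.B n m) * (((Real.sqrt (h / 2) : ℝ) : ℂ) * (p.A *ᵥ cplxCoord p h x) n) * g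
      = ((Real.sqrt (h / 2) : ℝ) : ℂ) * ((p.Bᴴ * p.A) *ᵥ cplxCoord p h x) m * g := by
    rw [← sum_conj_mul_mulVec, Finset.mul_sum, Finset.sum_mul]
    exact Finset.sum_congr rfl fun n _ => by ring
  have h4 : ∑ n, conj (p.A n m) * (-((Real.sqrt (2 * h) : ℝ) : ℂ) *
        ∑ k, p.A⁻¹ k n * polyPacket p h (pderiv k P) x
        + ((Real.sqrt (h / 2) : ℝ) : ℂ) * (p.B *ᵥ cplxCoord p h x) n * g)
      = ((Real.sqrt (h / 2) : ℝ) : ℂ) * ((p.Aᴴ * p.B) *ᵥ cplxCoord p h x) m * g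
        - ((Real.sqrt (2 * h) : ℝ) : ℂ) *
          ∑ k, shearMat p.A k m * polyPacket p h (pderiv k P) x := by
    rw [← sum_conj_mul_mulVec]
    have h5 : ∑ k, shearMat p.A k m * polyPacket p h (pderiv k P) x
        = ∑ n, conj (p.A n m) * ∑ k, p.A⁻¹ k n * polyPacket p h (pderiv k P) x := by
      simp only [shearMat, Matrix.mul_apply, Matrix.map_apply, Finset.sum_mul, Finset.mul_sum]
      rw [Finset.sum_comm]
      exact Finset.sum_congr rfl fun n _ => Finset.sum_congr rfl fun k _ => by ring
    rw [h5]
    simp only [Finset.mul_sum, Finset.sum_mul, mul_add, Finset.sum_add_distrib]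
    rw [sub_eq_add_neg, ← Finset.sum_neg_distrib, add_comm]
    congr 1
    · exact Finset.sum_congr rfl fun n _ => by ring
    · refine Finset.sum_congr rfl fun n _ => ?_
      rw [← Finset.sum_neg_distrib]
      exact Finset.sum_congr rfl fun n _ => by ring
  -- The normalization A^*B + B^*A = 2I collects the two linear terms into multiplication by w_m.
  have h6 : ((p.Aᴴ * p.B) *ᵥ cplxCoord p h x) m + ((p.Bᴴ * p.A) *ᵥ cplxCoord p h x) m
      = 2 * cplxCoord p h x m := by
    rw [← Pi.add_apply, ← Matrix.add_mulVec, hp.herm]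
    simp [Matrix.smul_mulVec]
  have h7 : ((Real.sqrt (2 * h) : ℝ) : ℂ) = 2 * ((Real.sqrt (h / 2) : ℝ) : ℂ) := by
    rw [show 2 * h = 2 ^ 2 * (h / 2) by ring, Real.sqrt_mul (by norm_num),
      Real.sqrt_sq (by norm_num)]
    push_cast
    ring
  have h8 : ((Real.sqrt (h / 2) : ℝ) : ℂ) ≠ 0 := by
    have : Real.sqrt (h / 2) ≠ 0 := by positivity
    exact_mod_cast this
  rw [h3, h4]
  simp only [polyPacket_smul, Pi.smul_apply, smul_eq_mul]
  push_cast
  rw [h7]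
  field_simp
  linear_combination g * h6

/-- The Gaussian corresponds to the polynomial 1, and the map from polynomials to packets
intertwines R_m with the raising operator. From here on, questions about the φ_j become questions
about polynomials. -/
theorem phi_eq_polyPacket {p : PacketData d} (hp : Admissible p.A p.B) {h : ℝ} (hh : 0 < h)
    (j : MIdx d) : phi p h j = polyPacket p h (hermPoly (shearMat p.A) j) := by
  ext x
  unfold phi
  rw [← polyPacket_one, iterOp_semiconj (raising p h) (fun m P => raisePoly (shearMat p.A) m P)
    (polyPacket p h) (fun m P => raising_polyPacket hp hh m P) j 1, hermPoly, polyPacket_smul]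
  rfl

/-- The annihilation identity, in the form used for integration by parts. -/
theorem lowering_polyPacket {p : PacketData d} (hp : Admissible p.A p.B) {h : ℝ} (hh : 0 < h)
    (m : Fin d) (P : Poly d) (x : Conf d) :
    ∑ n, p.B n m * ((x n - p.a n : ℝ) : ℂ) * polyPacket p h P x - ∑ n, p.A n m *
        (-(h : ℂ) * partialD n (polyPacket p h P) x + Complex.I * p.η n * polyPacket p h P x)
      = ((Real.sqrt (2 * h) : ℝ) : ℂ) * polyPacket p h (pderiv m P) x := by
  set g := polyPacket p h P x with hg
  have h1 : ∀ n, ((x n - p.a n : ℝ) : ℂ)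
      = ((Real.sqrt (h / 2) : ℝ) : ℂ) * (p.A *ᵥ cplxCoord p h x) n := fun n => by
    have := congrFun (disp_eq hp hh x) n
    simpa [disp] using this
  simp only [hg, momentum_polyPacket hp hh, h1]
  rw [← hg]
  have h3 : ∑ n, p.B n m * (((Real.sqrt (h / 2) : ℝ) : ℂ) * (p.A *ᵥ cplxCoord p h x) n) * g
      = ((Real.sqrt (h / 2) : ℝ) : ℂ) * ((p.Bᵀ * p.A) *ᵥ cplxCoord p h x) m * g := by
    rw [← sum_mul_mulVec, Finset.mul_sum, Finset.sum_mul]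
    exact Finset.sum_congr rfl fun n _ => by ring
  have h4 : ∑ n, p.A n m * (-((Real.sqrt (2 * h) : ℝ) : ℂ) *
        ∑ k, p.A⁻¹ k n * polyPacket p h (pderiv k P) x
        + ((Real.sqrt (h / 2) : ℝ) : ℂ) * (p.B *ᵥ cplxCoord p h x) n * g)
      = ((Real.sqrt (h / 2) : ℝ) : ℂ) * ((p.Aᵀ * p.B) *ᵥ cplxCoord p h x) m * g
        - ((Real.sqrt (2 * h) : ℝ) : ℂ) * polyPacket p h (pderiv m P) x := by
    rw [← sum_mul_mulVec]
    have h5 : polyPacket p h (pderiv m P) x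
        = ∑ n, p.A n m * ∑ k, p.A⁻¹ k n * polyPacket p h (pderiv k P) x := by
      have h6 : ∀ k, ∑ n, p.A⁻¹ k n * p.A n m = if k = m then 1 else 0 := fun k => by
        rw [← Matrix.mul_apply, hp.inv_mul, Matrix.one_apply]
      simp only [Finset.mul_sum]
      rw [Finset.sum_comm]
      have : ∀ k, ∑ n, p.A n m * (p.A⁻¹ k n * polyPacket p h (pderiv k P) x)
          = (if k = m then 1 else 0) * polyPacket p h (pderiv k P) x := fun k => by
        rw [← h6, Finset.sum_mul]
        exact Finset.sum_congr rfl fun n _ => by ring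
      simp [this]
    rw [h5]
    simp only [Finset.mul_sum, Finset.sum_mul, mul_add, Finset.sum_add_distrib]
    rw [sub_eq_add_neg, ← Finset.sum_neg_distrib, add_comm]
    congr 1
    · exact Finset.sum_congr rfl fun n _ => by ring
    · refine Finset.sum_congr rfl fun n _ => ?_
      rw [← Finset.sum_neg_distrib]
      exact Finset.sum_congr rfl fun n _ => by ring
  -- Here the terms linear in w cancel because AᵗB = BᵗA; only the derivative survives.
  rw [h3, h4, sub_eq_zero.1 hp.symm]
  ring

/-! ### Gaussian bounds and integrability -/

/-- The vector x − a is real, so its bilinear form with B A⁻¹ equals (ħ/2) w^*A^*B w. The real part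
of w^*A^*B w is |w|², because A^*B + B^*A = 2I. -/
theorem norm_phiZero_sq {p : PacketData d} (hp : Admissible p.A p.B) {h : ℝ} (hh : 0 < h)
    (x : Conf d) : ‖phiZero p h x‖ ^ 2 =
      (Real.pi ^ (-(d : ℝ) / 4) * h ^ (-(d : ℝ) / 4)) ^ 2 * (‖p.rootDet‖⁻¹) ^ 2 *
        Real.exp (-(∑ k, ‖cplxCoord p h x k‖ ^ 2) / 2) := by
  set w := cplxCoord p h x with hw
  have h1 : disp p x ⬝ᵥ ((p.B * p.A⁻¹) *ᵥ disp p x)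
      = ((h / 2 : ℝ) : ℂ) * (star w ⬝ᵥ ((p.Aᴴ * p.B) *ᵥ w)) := by
    have hstar : star (disp p x) = disp p x := by
      ext n; simp [disp]
    have h2 : (p.B * p.A⁻¹) *ᵥ disp p x = ((Real.sqrt (h / 2) : ℝ) : ℂ) • (p.B *ᵥ w) := by
      rw [disp_eq hp hh, Matrix.mulVec_smul, Matrix.mulVec_mulVec, Matrix.mul_assoc, hp.inv_mul,
        Matrix.mul_one]
    rw [h2]
    conv_lhs => rw [← hstar, disp_eq hp hh]
    rw [star_smul, smul_dotProduct, dotProduct_smul, Matrix.star_mulVec, ← Matrix.dotProduct_mulVec,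
      Matrix.mulVec_mulVec]
    simp only [smul_eq_mul, RCLike.star_def, Complex.conj_ofReal]
    rw [← mul_assoc, ← Complex.ofReal_mul, Real.mul_self_sqrt (by positivity)]
  have h2 : (star w ⬝ᵥ ((p.Aᴴ * p.B) *ᵥ w)).re = ∑ k, ‖w k‖ ^ 2 := by
    have h3 : star w ⬝ᵥ ((p.Aᴴ * p.B) *ᵥ w) + star w ⬝ᵥ ((p.Bᴴ * p.A) *ᵥ w)
        = 2 * ((∑ k, ‖w k‖ ^ 2 : ℝ) : ℂ) := by
      rw [← dotProduct_add, ← Matrix.add_mulVec, hp.herm, Matrix.smul_mulVec, Matrix.one_mulVec,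
        dotProduct_smul]
      simp [dotProduct, Complex.conj_mul']
    have h4 : star w ⬝ᵥ ((p.Bᴴ * p.A) *ᵥ w) = conj (star w ⬝ᵥ ((p.Aᴴ * p.B) *ᵥ w)) := by
      change _ = star _
      rw [Matrix.star_dotProduct, Matrix.star_mulVec, Matrix.conjTranspose_mul,
        Matrix.conjTranspose_conjTranspose, ← Matrix.dotProduct_mulVec]
    rw [h4, Complex.add_conj] at h3
    have h5 : ((star w ⬝ᵥ ((p.Aᴴ * p.B) *ᵥ w)).re : ℂ) = ((∑ k, ‖w k‖ ^ 2 : ℝ) : ℂ) := by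
      apply mul_left_cancel₀ (two_ne_zero' ℂ)
      exact_mod_cast h3
    exact_mod_cast h5
  have h3 : (-(disp p x ⬝ᵥ ((p.B * p.A⁻¹) *ᵥ disp p x)) / (2 * (h : ℂ))
      + Complex.I * ((fun n => ((p.η n : ℝ) : ℂ)) ⬝ᵥ disp p x) / (h : ℂ)).re
      = -(∑ k, ‖w k‖ ^ 2) / 4 := by
    have h4 : (fun n => ((p.η n : ℝ) : ℂ)) ⬝ᵥ disp p x
        = ((∑ n, p.η n * (x n - p.a n) : ℝ) : ℂ) := by
      simp [dotProduct, disp]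
    have h5 : -(((h / 2 : ℝ) : ℂ) * (star w ⬝ᵥ ((p.Aᴴ * p.B) *ᵥ w))) / (2 * (h : ℂ))
        = ((-1 / 4 : ℝ) : ℂ) * (star w ⬝ᵥ ((p.Aᴴ * p.B) *ᵥ w)) := by
      have : (h : ℂ) ≠ 0 := by exact_mod_cast hh.ne'
      push_cast
      field_simp
      ring
    have h6 : ∀ r : ℝ, Complex.I * (r : ℂ) / (h : ℂ) = ((r / h : ℝ) : ℂ) * Complex.I := fun r => by
      push_cast
      ring
    rw [h1, h4, h5, h6, Complex.add_re, Complex.re_ofReal_mul, h2]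
    simp
    ring
  have h7 : ‖phiZero p h x‖ = (Real.pi ^ (-(d : ℝ) / 4) * h ^ (-(d : ℝ) / 4)) * ‖p.rootDet‖⁻¹ *
      Real.exp (-(∑ k, ‖w k‖ ^ 2) / 4) := by
    change ‖((Real.pi ^ (-(d : ℝ) / 4) * h ^ (-(d : ℝ) / 4) : ℝ) : ℂ) * p.rootDet⁻¹ *
      Complex.exp (-(disp p x ⬝ᵥ ((p.B * p.A⁻¹) *ᵥ disp p x)) / (2 * (h : ℂ))
      + Complex.I * ((fun n => ((p.η n : ℝ) : ℂ)) ⬝ᵥ disp p x) / (h : ℂ))‖ = _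
    rw [norm_mul, norm_mul, Complex.norm_exp, h3, norm_inv, Complex.norm_real,
      Real.norm_of_nonneg (by positivity)]
  rw [h7, mul_pow, mul_pow, ← Real.exp_nat_mul]
  congr 2
  push_cast
  ring

theorem norm_disp_sq_le {p : PacketData d} (hp : Admissible p.A p.B) {h : ℝ} (hh : 0 < h) {K : ℝ}
    (hK : ∀ i j, ‖p.A i j‖ ≤ K) (x : Conf d) :
    ‖x - p.a‖ ^ 2 ≤ (d * K) ^ 2 * (h / 2) * ∑ k, ‖cplxCoord p h x k‖ ^ 2 := by
  set w := cplxCoord p h x with hw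
  have h1 : ∀ n, (x n - p.a n) ^ 2 ≤ h / 2 * (d * K ^ 2 * ∑ k, ‖w k‖ ^ 2) := fun n => by
    have h2 := congrFun (disp_eq hp hh x) n
    have h3 : |x n - p.a n| = Real.sqrt (h / 2) * ‖(p.A *ᵥ w) n‖ := by
      have := congrArg norm h2
      simpa [disp, ← Complex.ofReal_sub, abs_of_nonneg (Real.sqrt_nonneg (h / 2)), ← hw,
        -Nat.ofNat_nonneg, -Real.sqrt_div'] using this
    rw [← sq_abs, h3, mul_pow, Real.sq_sqrt (by positivity)]
    gcongr
    have h4 : ‖(p.A *ᵥ w) n‖ ≤ ∑ k, ‖p.A n k‖ * ‖w k‖ := by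
      simp only [Matrix.mulVec, dotProduct]
      exact (norm_sum_le _ _).trans (Finset.sum_le_sum fun k _ => norm_mul_le _ _)
    have h5 := Finset.sum_mul_sq_le_sq_mul_sq Finset.univ (fun k => ‖p.A n k‖) (fun k => ‖w k‖)
    have h6 : ∑ k, ‖p.A n k‖ ^ 2 ≤ d * K ^ 2 := by
      refine (Finset.sum_le_card_nsmul _ _ (K ^ 2) fun k _ => ?_).trans (by simp)
      exact pow_le_pow_left₀ (norm_nonneg _) (hK n k) 2
    calc ‖(p.A *ᵥ w) n‖ ^ 2 ≤ (∑ k, ‖p.A n k‖ * ‖w k‖) ^ 2 :=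
          pow_le_pow_left₀ (norm_nonneg _) h4 2
      _ ≤ _ := h5.trans (mul_le_mul_of_nonneg_right h6 (Finset.sum_nonneg fun _ _ => by positivity))
  rw [EuclideanSpace.norm_sq_eq]
  simp only [PiLp.sub_apply, Real.norm_eq_abs, sq_abs]
  refine (Finset.sum_le_card_nsmul _ _ _ fun n _ => h1 n).trans (le_of_eq ?_)
  simp
  ring

theorem exists_norm_eval_le (P : Poly d) : ∀ ε : ℝ, 0 < ε → ∃ C : ℝ, 0 ≤ C ∧
    ∀ w : Fin d → ℂ, ‖MvPolynomial.eval w P‖ ≤ C * Real.exp (ε * ∑ k, ‖w k‖ ^ 2) := by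
  induction P using MvPolynomial.induction_on with
  | C z =>
    intro ε hε
    refine ⟨‖z‖, norm_nonneg _, fun w => ?_⟩
    rw [MvPolynomial.eval_C]
    exact le_mul_of_one_le_right (norm_nonneg _) (Real.one_le_exp (by positivity))
  | add P Q hP hQ =>
    intro ε hε
    obtain ⟨C, hC0, hC⟩ := hP ε hε
    obtain ⟨C', hC0', hC'⟩ := hQ ε hε
    refine ⟨C + C', by positivity, fun w => ?_⟩
    rw [map_add, add_mul]
    exact (norm_add_le _ _).trans (add_le_add (hC w) (hC' w))
  | mul_X P n hP =>
    intro ε hε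
    obtain ⟨C, hC0, hC⟩ := hP (ε / 2) (by positivity)
    refine ⟨C * (1 + 2 / ε), by positivity, fun w => ?_⟩
    set s := ∑ k, ‖w k‖ ^ 2 with hs
    have h1 : ‖w n‖ ^ 2 ≤ s :=
      Finset.single_le_sum (f := fun k => ‖w k‖ ^ 2) (fun _ _ => by positivity) (Finset.mem_univ n)
    have hs0 : 0 ≤ s := (sq_nonneg _).trans h1
    have h2 : ‖w n‖ ≤ (1 + 2 / ε) * Real.exp (ε / 2 * s) := by
      calc ‖w n‖ ≤ 1 + s := by nlinarith [sq_nonneg (‖w n‖ - 1)]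
        _ ≤ (1 + 2 / ε) * (ε / 2 * s + 1) := by
          have : (1 + 2 / ε) * (ε / 2 * s + 1) = 1 + s + ε / 2 * s + 2 / ε := by
            field_simp
            ring
          rw [this]
          have h3 : 0 ≤ ε / 2 * s := by positivity
          have h4 : 0 ≤ 2 / ε := by positivity
          linarith
        _ ≤ _ := by gcongr; exact Real.add_one_le_exp _
    rw [map_mul, MvPolynomial.eval_X, norm_mul]
    calc _ ≤ (C * Real.exp (ε / 2 * s)) * ((1 + 2 / ε) * Real.exp (ε / 2 * s)) :=
          mul_le_mul (hC w) h2 (norm_nonneg _) (by positivity)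
      _ = C * (1 + 2 / ε) * (Real.exp (ε / 2 * s) * Real.exp (ε / 2 * s)) := by ring
      _ = _ := by rw [← Real.exp_add]; ring_nf

theorem integrable_exp_neg_mul_norm_sub_sq {c : ℝ} (hc : 0 < c) (a : Conf d) :
    Integrable (fun x : Conf d => Real.exp (-c * ‖x - a‖ ^ 2)) := by
  have h1 : Integrable (fun x : Conf d => Real.exp (-c * ‖x‖ ^ 2)) := by
    have h2 := GaussianFourier.integrable_cexp_neg_mul_sq_norm_add (V := Conf d) (b := (c : ℂ))
      (by simpa using hc) 0 0
    have h3 := h2.norm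
    refine h3.congr (Filter.Eventually.of_forall fun x => ?_)
    simp only [Complex.norm_exp]
    congr 1
    rw [zero_mul, add_zero, ← Complex.ofReal_pow, ← Complex.ofReal_neg, ← Complex.ofReal_mul,
      Complex.ofReal_re]
  exact h1.comp_sub_right a

theorem exists_norm_entry_le (A : Matrix (Fin d) (Fin d) ℂ) : ∃ K, ∀ i j, ‖A i j‖ ≤ K :=
  ⟨∑ i, ∑ j, ‖A i j‖, fun i j =>
    (Finset.single_le_sum (f := fun j => ‖A i j‖) (fun _ _ => norm_nonneg _)
      (Finset.mem_univ j)).trans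
    (Finset.single_le_sum (f := fun i => ∑ j, ‖A i j‖)
      (fun _ _ => Finset.sum_nonneg fun _ _ => norm_nonneg _) (Finset.mem_univ i))⟩

section inner

variable {p : PacketData d} {h : ℝ}

theorem integrable_conj_mul_polyPacket (hp : Admissible p.A p.B) (hh : 0 < h) (P Q : Poly d) :
    Integrable (fun x => conj (polyPacket p h P x) * polyPacket p h Q x) := by
  obtain ⟨K, hK⟩ := exists_norm_entry_le p.A
  -- Two factors exp(|w|²/8) against exp(−|w|²/2) leave exp(−|w|²/4).
  obtain ⟨C, hC0, hC⟩ := exists_norm_eval_le P (1 / 8) (by norm_num)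
  obtain ⟨C', hC0', hC'⟩ := exists_norm_eval_le Q (1 / 8) (by norm_num)
  -- The summand 1 keeps γ positive when d K = 0.
  set γ := (d * K) ^ 2 * (h / 2) + 1 with hγ
  have hγ0 : 0 < γ := by positivity
  set D := (Real.pi ^ (-(d : ℝ) / 4) * h ^ (-(d : ℝ) / 4)) ^ 2 * (‖p.rootDet‖⁻¹) ^ 2 with hD
  have hcont : ∀ P, Continuous (polyPacket p h P) := fun P =>
    (differentiable_polyPacket hp h P).continuous
  refine ((integrable_exp_neg_mul_norm_sub_sq (c := 1 / (4 * γ)) (by positivity) p.a).const_mul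
    (C * C' * D)).mono' ?_ (Filter.Eventually.of_forall fun x => ?_)
  · exact ((Complex.continuous_conj.comp (hcont P)).mul (hcont Q)).aestronglyMeasurable
  · set w := cplxCoord p h x with hw
    set s := ∑ k, ‖w k‖ ^ 2 with hs
    have hs0 : 0 ≤ s := Finset.sum_nonneg fun _ _ => by positivity
    have h1 : ‖x - p.a‖ ^ 2 ≤ γ * s := by
      have := norm_disp_sq_le hp hh hK x
      rw [← hw, ← hs] at this
      rw [hγ, add_mul]
      linarith
    have h2 : ‖conj (polyPacket p h P x) * polyPacket p h Q x‖
        = ‖MvPolynomial.eval w P‖ * ‖MvPolynomial.eval w Q‖ * (‖phiZero p h x‖ ^ 2) := by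
      simp only [polyPacket, map_mul, norm_mul, RCLike.norm_conj]
      ring
    rw [h2, norm_phiZero_sq hp hh, ← hD, ← hw, ← hs]
    calc _ ≤ (C * Real.exp (1 / 8 * s)) * (C' * Real.exp (1 / 8 * s)) * (D * Real.exp (-s / 2)) := by
          gcongr
          · exact hC w
          · exact hC' w
      _ = C * C' * D * (Real.exp (1 / 8 * s) * Real.exp (1 / 8 * s) * Real.exp (-s / 2)) := by ring
      _ = C * C' * D * Real.exp (-s / 4) := by
          rw [← Real.exp_add, ← Real.exp_add]
          ring_nf
      _ ≤ _ := by
          gcongr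
          have h3 : 1 / (4 * γ) * ‖x - p.a‖ ^ 2 ≤ s / 4 := by
            rw [div_mul_eq_mul_div, one_mul, div_le_div_iff₀ (by positivity) (by norm_num)]
            linarith
          linarith

/-- Polynomial packets are closed under ∂_n, so the integrability required for integration by parts
reduces to `integrable_conj_mul_polyPacket`. -/
theorem exists_partialD_polyPacket (hp : Admissible p.A p.B) (hh : 0 < h) (n : Fin d)
    (P : Poly d) : ∃ P', partialD n (polyPacket p h P) = polyPacket p h P' := by
  refine ⟨(h⁻¹ : ℂ) • ((Complex.I * p.η n) • P
    + ((Real.sqrt (2 * h) : ℝ) : ℂ) • ∑ k, p.A⁻¹ k n • pderiv k P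
    - ((Real.sqrt (h / 2) : ℝ) : ℂ) • ((∑ k, p.B n k • MvPolynomial.X k) * P)), ?_⟩
  ext x
  have h1 := momentum_polyPacket hp hh P n x
  have hh' : (h : ℂ) ≠ 0 := by exact_mod_cast hh.ne'
  have h2 : MvPolynomial.eval (cplxCoord p h x)
      (∑ k, p.B n k • (MvPolynomial.X k : Poly d)) = (p.B *ᵥ cplxCoord p h x) n := by
    simp [Matrix.mulVec, dotProduct, MvPolynomial.smul_eval]
  simp only [polyPacket_smul, polyPacket_add, polyPacket_sub, Pi.smul_apply, Pi.add_apply,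
    Pi.sub_apply, polyPacket_sum, polyPacket_mul, h2, smul_eq_mul]
  rw [eq_inv_mul_iff_mul_eq₀ hh']
  linear_combination -h1

theorem hasFDerivAt_conj {f : Conf d → ℂ} (hf : Differentiable ℝ f) (x : Conf d) :
    HasFDerivAt (fun x => conj (f x))
      ((Complex.conjCLE : ℂ →L[ℝ] ℂ) ∘L fderiv ℝ f x) x :=
  (Complex.conjCLE : ℂ →L[ℝ] ℂ).hasFDerivAt.comp x (hf x).hasFDerivAt

theorem integral_conj_partialD (hp : Admissible p.A p.B) (hh : 0 < h) (n : Fin d)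
    (P Q : Poly d) :
    ∫ x, conj (polyPacket p h P x) * partialD n (polyPacket p h Q) x
      = -∫ x, conj (partialD n (polyPacket p h P) x) * polyPacket p h Q x := by
  have hdiff := fun P => differentiable_polyPacket hp h P
  have hfd : ∀ x, fderiv ℝ (fun x => conj (polyPacket p h P x)) x (EuclideanSpace.single n 1)
      = conj (partialD n (polyPacket p h P) x) := fun x => by
    rw [(hasFDerivAt_conj (hdiff P) x).fderiv]
    rfl
  obtain ⟨P', hP'⟩ := exists_partialD_polyPacket hp hh n P
  obtain ⟨Q', hQ'⟩ := exists_partialD_polyPacket hp hh n Q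
  have := integral_mul_fderiv_eq_neg_fderiv_mul_of_integrable (μ := volume)
    (f := fun x => conj (polyPacket p h P x)) (g := polyPacket p h Q)
    (v := EuclideanSpace.single n 1) ?_ ?_ (integrable_conj_mul_polyPacket hp hh P Q)
    (fun x _ => (hasFDerivAt_conj (hdiff P) x).differentiableAt) (fun x _ => hdiff Q x)
  · simp only [hfd] at this
    exact this
  · simp only [hfd, hP']
    exact integrable_conj_mul_polyPacket hp hh P' Q
  · change Integrable (fun x => conj (polyPacket p h P x) * partialD n (polyPacket p h Q) x)
    rw [hQ']
    exact integrable_conj_mul_polyPacket hp hh P Q'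

/-! ### Inner products and orthogonality of the states -/

/-- The inner product of two polynomial packets. -/
def packetInner (p : PacketData d) (h : ℝ) (P Q : Poly d) : ℂ :=
  ∫ x, conj (polyPacket p h P x) * polyPacket p h Q x

theorem packetInner_conj (P Q : Poly d) :
    conj (packetInner p h P Q) = packetInner p h Q P := by
  unfold packetInner
  rw [← integral_conj]
  simp [mul_comm]

theorem packetInner_smul_right (P Q : Poly d) (z : ℂ) :
    packetInner p h P (z • Q) = z * packetInner p h P Q := by
  unfold packetInner
  rw [← integral_const_mul]
  simp only [polyPacket_smul, Pi.smul_apply, smul_eq_mul]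
  congr 1
  ext x
  ring

theorem packetInner_smul_left (P Q : Poly d) (z : ℂ) :
    packetInner p h (z • P) Q = conj z * packetInner p h P Q := by
  rw [← packetInner_conj, packetInner_smul_right, map_mul, packetInner_conj]

theorem packetInner_sum_right (hp : Admissible p.A p.B) (hh : 0 < h) (P : Poly d) {ι : Type*}
    (s : Finset ι) (f : ι → Poly d) :
    packetInner p h P (∑ i ∈ s, f i) = ∑ i ∈ s, packetInner p h P (f i) := by
  unfold packetInner
  rw [← integral_finsetSum s fun i _ => integrable_conj_mul_polyPacket hp hh P (f i)]
  simp only [polyPacket_sum, Finset.mul_sum]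

/-- R_m and ∂_m are adjoint: the terms in x and η cancel pointwise, and the remaining difference of
integrands is a combination of derivatives ∂_n of conj(P φ_0) Q φ_0, whose integrals vanish. -/
theorem packetInner_raisePoly (hp : Admissible p.A p.B) (hh : 0 < h) (m : Fin d)
    (P Q : Poly d) :
    packetInner p h (raisePoly (shearMat p.A) m P) Q = packetInner p h P (pderiv m Q) := by
  rw [← sub_eq_zero]
  unfold packetInner
  rw [← integral_sub (integrable_conj_mul_polyPacket hp hh _ _)
    (integrable_conj_mul_polyPacket hp hh _ _)]
  set c : ℂ := ((1 / Real.sqrt (2 * h) : ℝ) : ℂ) with hc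
  have h1 : ∀ x, conj (polyPacket p h (raisePoly (shearMat p.A) m P) x) * polyPacket p h Q x
      - conj (polyPacket p h P x) * polyPacket p h (pderiv m Q) x
      = ∑ n, -(c * h * p.A n m) * (conj (partialD n (polyPacket p h P) x) * polyPacket p h Q x
        + conj (polyPacket p h P x) * partialD n (polyPacket p h Q) x) := fun x => by
    have hc1 : c * ((Real.sqrt (2 * h) : ℝ) : ℂ) = 1 := by
      rw [hc]
      norm_cast
      have : Real.sqrt (2 * h) ≠ 0 := by positivity
      field_simp
    have h2 : polyPacket p h (pderiv m Q) x = c * (∑ n, p.B n m * ((x n - p.a n : ℝ) : ℂ)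
        * polyPacket p h Q x - ∑ n, p.A n m * (-(h : ℂ) * partialD n (polyPacket p h Q) x
          + Complex.I * p.η n * polyPacket p h Q x)) := by
      rw [lowering_polyPacket hp hh, ← mul_assoc, hc1, one_mul]
    rw [h2, ← raising_polyPacket hp hh, raising, ← hc, ← Finset.sum_sub_distrib, Finset.mul_sum,
      ← Finset.sum_sub_distrib]
    simp only [map_mul, map_sum, map_sub, map_neg, Complex.conj_conj, Complex.conj_I,
      Complex.conj_ofReal, hc]
    rw [← hc, Finset.mul_sum, Finset.mul_sum, Finset.sum_mul, Finset.mul_sum,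
      ← Finset.sum_sub_distrib]
    refine Finset.sum_congr rfl fun n _ => ?_
    linear_combination (c * p.A n m * h * conj (partialD n (polyPacket p h P) x)
      * polyPacket p h Q x) * Complex.I_sq
  simp only [h1]
  obtain hP := fun n => exists_partialD_polyPacket hp hh n P
  obtain hQ := fun n => exists_partialD_polyPacket hp hh n Q
  have i1 : ∀ n, Integrable fun x =>
      conj (partialD n (polyPacket p h P) x) * polyPacket p h Q x := fun n => by
    obtain ⟨P', hP'⟩ := hP n
    rw [hP']
    exact integrable_conj_mul_polyPacket hp hh P' Q
  have i2 : ∀ n, Integrable fun x =>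
      conj (polyPacket p h P x) * partialD n (polyPacket p h Q) x := fun n => by
    obtain ⟨Q', hQ'⟩ := hQ n
    rw [hQ']
    exact integrable_conj_mul_polyPacket hp hh P Q'
  rw [integral_finsetSum _ fun n _ => ((i1 n).fun_add (i2 n)).const_mul _]
  refine Finset.sum_eq_zero fun n _ => ?_
  rw [integral_const_mul, integral_add (i1 n) (i2 n), integral_conj_partialD hp hh]
  simp

/-- Induction on j moves each R_m across the inner product as ∂_m, which lowers i. The diagonal
value is left as the squared norm of the ground state, for which an upper bound is enough. -/
theorem packetInner_hermPoly (hp : Admissible p.A p.B) (hh : 0 < h) (j i : MIdx d) :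
    packetInner p h (hermPoly (shearMat p.A) j) (hermPoly (shearMat p.A) i)
      = if j = i then packetInner p h 1 1 else 0 := by
  have hS := hp.shearMat_symm
  have hs : ∀ (j : MIdx d) (m : Fin d), ((Real.sqrt (j m + 1) : ℝ) : ℂ) ≠ 0 := fun j m => by
    have : Real.sqrt (j m + 1) ≠ 0 := by positivity
    exact_mod_cast this
  induction j using midx_induction generalizing i with
  | h0 =>
    by_cases hi : ∀ m, i m = 0
    · have : i = 0 := funext hi
      simp [this, hermPoly_zero]
    · push Not at hi
      obtain ⟨m, hm⟩ := hi
      have hne : (0 : MIdx d) ≠ i := fun h0 => hm (h0 ▸ rfl)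
      obtain ⟨i, rfl⟩ := exists_add_single i m hm
      rw [if_neg hne, hermPoly_zero]
      apply mul_left_cancel₀ (hs i m)
      rw [← packetInner_smul_right, ← raisePoly_hermPoly hS, ← packetInner_conj,
        packetInner_raisePoly hp hh]
      simp [packetInner, polyPacket]
  | hs j m ih =>
    apply mul_left_cancel₀ (hs j m)
    have h1 : ((Real.sqrt (j m + 1) : ℝ) : ℂ) * packetInner p h
        (hermPoly (shearMat p.A) (j + Pi.single m 1)) (hermPoly (shearMat p.A) i)
        = packetInner p h (hermPoly (shearMat p.A) j) (pderiv m (hermPoly (shearMat p.A) i)) := by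
      rw [← packetInner_raisePoly hp hh, raisePoly_hermPoly hS, packetInner_smul_left,
        Complex.conj_ofReal]
    rw [h1]
    by_cases hi : i m = 0
    · have hne : j + Pi.single m 1 ≠ i := fun h0 => by
        have := congrFun h0 m
        simp [hi] at this
      rw [pderiv_hermPoly_of_eq_zero hS m i hi, if_neg hne]
      simp [packetInner, polyPacket]
    · obtain ⟨i, rfl⟩ := exists_add_single i m hi
      rw [pderiv_hermPoly_add_single hS, packetInner_smul_right, ih]
      by_cases hji : j = i
      · simp [hji]
      · simp [hji]

/-- A comparison with exp(−|x − a|²/(ħβ)), whose integral (πħβ)^{d/2} cancels the powers of π and ħ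
in the normalization. The bound is therefore independent of ħ. -/
theorem norm_packetInner_one_le (hp : Admissible p.A p.B) (hh : 0 < h) {K : ℝ}
    (hK : ∀ i j, ‖p.A i j‖ ≤ K) :
    ‖packetInner p h 1 1‖ ≤ (‖p.rootDet‖⁻¹) ^ 2 * ((d * K) ^ 2 + 1) ^ ((d : ℝ) / 2) := by
  set β := (d * K) ^ 2 + 1 with hβ
  have hβ0 : 0 < β := by positivity
  set D := (Real.pi ^ (-(d : ℝ) / 4) * h ^ (-(d : ℝ) / 4)) ^ 2 * (‖p.rootDet‖⁻¹) ^ 2 with hD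
  have hint := (integrable_exp_neg_mul_norm_sub_sq (c := 1 / (h * β)) (by positivity) p.a).const_mul D
  have h1 : ‖packetInner p h 1 1‖ ≤ ∫ x : Conf d, D * Real.exp (-(1 / (h * β)) * ‖x - p.a‖ ^ 2) := by
    refine norm_integral_le_of_norm_le hint (Filter.Eventually.of_forall fun x => ?_)
    set s := ∑ k, ‖cplxCoord p h x k‖ ^ 2 with hs
    have hs0 : 0 ≤ s := Finset.sum_nonneg fun _ _ => by positivity
    have h2 : ‖conj (polyPacket p h 1 x) * polyPacket p h 1 x‖ = ‖phiZero p h x‖ ^ 2 := by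
      rw [polyPacket_one, norm_mul, RCLike.norm_conj, sq]
    rw [h2, norm_phiZero_sq hp hh, ← hD, ← hs]
    gcongr
    have h3 := norm_disp_sq_le hp hh hK x
    rw [← hs] at h3
    have h4 : 1 / (h * β) * ‖x - p.a‖ ^ 2 ≤ s / 2 := by
      rw [div_mul_eq_mul_div, one_mul, div_le_div_iff₀ (by positivity) (by norm_num)]
      have : 0 ≤ s * h := by positivity
      rw [hβ]
      linarith
    linarith
  refine h1.trans (le_of_eq ?_)
  rw [integral_const_mul, integral_sub_right_eq_self
    (fun x : Conf d => Real.exp (-(1 / (h * β)) * ‖x‖ ^ 2)) p.a,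
    GaussianFourier.integral_rexp_neg_mul_sq_norm (by positivity), hD]
  have h5 : Real.pi / (1 / (h * β)) = Real.pi * h * β := by field_simp
  have hpow : ∀ r : ℝ, 0 < r → (r ^ (-(d : ℝ) / 4)) ^ 2 * r ^ ((d : ℝ) / 2) = 1 := fun r hr => by
    rw [← Real.rpow_natCast, ← Real.rpow_mul hr.le, ← Real.rpow_add hr]
    convert Real.rpow_zero r using 2
    push_cast
    ring
  rw [h5, Real.mul_rpow (by positivity) hβ0.le, Real.mul_rpow Real.pi_pos.le hh.le, finrank_euclideanSpace,
    Fintype.card_fin, mul_pow]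
  linear_combination (‖p.rootDet‖⁻¹) ^ 2 * β ^ ((d : ℝ) / 2) *
    ((Real.pi ^ (-(d : ℝ) / 4)) ^ 2 * Real.pi ^ ((d : ℝ) / 2)) * hpow h hh
    + (‖p.rootDet‖⁻¹) ^ 2 * β ^ ((d : ℝ) / 2) * hpow Real.pi Real.pi_pos

namespace HasExpansion

variable {P : Poly d} {N : ℕ} {C : ℝ}

theorem packetInner_eq_zero (hp : Admissible p.A p.B) (hh : 0 < h)
    (hP : HasExpansion (shearMat p.A) P N C) (j : MIdx d) (hj : N < order j) :
    packetInner p h (SemiclassicalPacket.hermPoly (shearMat p.A) j) P = 0 := by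
  obtain ⟨c, rfl, -⟩ := hP
  rw [packetInner_sum_right hp hh]
  refine Finset.sum_eq_zero fun i hi => ?_
  have : j ≠ i := by
    rintro rfl
    rw [mem_idxLe] at hi
    omega
  rw [packetInner_smul_right, packetInner_hermPoly hp hh, if_neg this, mul_zero]

/-- By orthogonality, pairing with the states reads off the coefficients up to the squared norm of
the ground state; this turns an expansion into a column bound for matrix elements. -/
theorem sum_norm_packetInner_le (hp : Admissible p.A p.B) (hh : 0 < h)
    (hP : HasExpansion (shearMat p.A) P N C) (s : Finset (MIdx d)) :
    ∑ j ∈ s, ‖packetInner p h (SemiclassicalPacket.hermPoly (shearMat p.A) j) P‖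
      ≤ ‖packetInner p h 1 1‖ * C := by
  obtain ⟨c, rfl, hc⟩ := hP
  have h1 : ∀ j, packetInner p h (SemiclassicalPacket.hermPoly (shearMat p.A) j)
      (∑ i ∈ idxLe d N, c i • SemiclassicalPacket.hermPoly (shearMat p.A) i)
      = ∑ i ∈ idxLe d N, if j = i then c i * packetInner p h 1 1 else 0 := fun j => by
    rw [packetInner_sum_right hp hh]
    refine Finset.sum_congr rfl fun i _ => ?_
    rw [packetInner_smul_right, packetInner_hermPoly hp hh]
    split_ifs <;> simp
  simp only [h1]
  calc _ ≤ ∑ j ∈ s, ∑ i ∈ idxLe d N, if j = i then ‖c i‖ * ‖packetInner p h 1 1‖ else 0 := by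
        refine Finset.sum_le_sum fun j _ => (norm_sum_le _ _).trans
          (Finset.sum_le_sum fun i _ => ?_)
        split_ifs <;> simp
    _ = ∑ i ∈ idxLe d N, ∑ j ∈ s, if j = i then ‖c i‖ * ‖packetInner p h 1 1‖ else 0 :=
        Finset.sum_comm
    _ ≤ ∑ i ∈ idxLe d N, ‖c i‖ * ‖packetInner p h 1 1‖ := by
        refine Finset.sum_le_sum fun i _ => ?_
        rw [Finset.sum_ite_eq']
        split_ifs
        · exact le_rfl
        · positivity
    _ ≤ _ := by
        rw [← Finset.sum_mul, mul_comm]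
        exact mul_le_mul_of_nonneg_left hc (norm_nonneg _)

theorem integral_norm_sq_le (hp : Admissible p.A p.B) (hh : 0 < h)
    (hP : HasExpansion (shearMat p.A) P N C) :
    ∫ x, ‖polyPacket p h P x‖ ^ 2 ≤ ‖packetInner p h 1 1‖ * C ^ 2 := by
  have hC := hP.nonneg
  have h1 : ((∫ x, ‖polyPacket p h P x‖ ^ 2 : ℝ) : ℂ) = packetInner p h P P := by
    rw [← integral_complex_ofReal, packetInner]
    congr 1
    ext x
    rw [Complex.conj_mul']
    push_cast
    rfl
  have h2 : ∫ x, ‖polyPacket p h P x‖ ^ 2 ≤ ‖packetInner p h P P‖ := by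
    rw [← h1, Complex.norm_real]
    exact Real.le_norm_self _
  refine h2.trans ?_
  obtain ⟨c, hc1, hc⟩ := id hP
  conv_lhs => rw [show packetInner p h P P = packetInner p h P
    (∑ i ∈ idxLe d N, c i • SemiclassicalPacket.hermPoly (shearMat p.A) i) by rw [← hc1]]
  rw [packetInner_sum_right hp hh]
  calc _ ≤ ∑ i ∈ idxLe d N, ‖c i‖ * (‖packetInner p h 1 1‖ * C) := by
        refine (norm_sum_le _ _).trans (Finset.sum_le_sum fun i _ => ?_)
        rw [packetInner_smul_right, norm_mul, ← packetInner_conj, RCLike.norm_conj]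
        gcongr
        simpa using hP.sum_norm_packetInner_le hp hh {i}
    _ ≤ C * (‖packetInner p h 1 1‖ * C) := by
        rw [← Finset.sum_mul]
        gcongr
    _ = _ := by ring

end HasExpansion

theorem integrable_norm_sq_polyPacket (hp : Admissible p.A p.B) (hh : 0 < h) (P : Poly d) :
    Integrable (fun x => ‖polyPacket p h P x‖ ^ 2) := by
  refine (integrable_conj_mul_polyPacket hp hh P P).norm.congr
    (Filter.Eventually.of_forall fun x => ?_)
  simp [sq]

end inner

/-! ### Cauchy estimates for the potential -/

/-- The holomorphic partial derivative. -/
def cpartialD (n : Fin d) (G : EuclideanSpace ℂ (Fin d) → ℂ) : EuclideanSpace ℂ (Fin d) → ℂ :=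
  fun z => fderiv ℂ G z (EuclideanSpace.single n 1)

theorem analyticOnNhd_cpartialD {U : Set (EuclideanSpace ℂ (Fin d))}
    {G : EuclideanSpace ℂ (Fin d) → ℂ} (hG : AnalyticOnNhd ℂ G U) (n : Fin d) :
    AnalyticOnNhd ℂ (cpartialD n G) U :=
  (ContinuousLinearMap.apply ℂ ℂ (EuclideanSpace.single n 1 : EuclideanSpace ℂ (Fin d))).comp_analyticOnNhd
    hG.fderiv

theorem analyticOnNhd_iterate_cpartialD {U : Set (EuclideanSpace ℂ (Fin d))}
    {G : EuclideanSpace ℂ (Fin d) → ℂ} (hG : AnalyticOnNhd ℂ G U) (n : Fin d) (k : ℕ) :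
    AnalyticOnNhd ℂ ((cpartialD n)^[k] G) U := by
  induction k with
  | zero => exact hG
  | succ k ih =>
    rw [Function.iterate_succ_apply']
    exact analyticOnNhd_cpartialD ih n

theorem hasDerivAt_line (z e : EuclideanSpace ℂ (Fin d)) (w : ℂ) :
    HasDerivAt (fun w : ℂ => z + w • e) e w := by
  simpa using ((hasDerivAt_id w).smul_const e).const_add z

/-- Restriction to a complex line parallel to an axis makes the one-variable Cauchy estimate
available. -/
theorem iteratedDeriv_line {U : Set (EuclideanSpace ℂ (Fin d))} (hU : IsOpen U)
    {G : EuclideanSpace ℂ (Fin d) → ℂ} (hG : AnalyticOnNhd ℂ G U) (n : Fin d)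
    (z : EuclideanSpace ℂ (Fin d)) (k : ℕ) (w : ℂ) (hw : z + w • EuclideanSpace.single n 1 ∈ U) :
    iteratedDeriv k (fun w : ℂ => G (z + w • EuclideanSpace.single n 1)) w
      = ((cpartialD n)^[k] G) (z + w • EuclideanSpace.single n 1) := by
  induction k generalizing w with
  | zero => simp
  | succ k ih =>
    rw [iteratedDeriv_succ, Function.iterate_succ_apply']
    have hcont : Continuous fun w : ℂ => z + w • (EuclideanSpace.single n 1 : EuclideanSpace ℂ (Fin d)) := by
      fun_prop
    have hev : iteratedDeriv k (fun w : ℂ => G (z + w • EuclideanSpace.single n 1)) =ᶠ[nhds w]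
        fun w => ((cpartialD n)^[k] G) (z + w • EuclideanSpace.single n 1) := by
      filter_upwards [(hU.preimage hcont).mem_nhds hw] with w' hw'
      exact ih w' hw'
    rw [hev.deriv_eq]
    have h1 := ((analyticOnNhd_iterate_cpartialD hG n k) _ hw).differentiableAt.hasFDerivAt
    exact (h1.comp_hasDerivAt w (hasDerivAt_line z _ w)).deriv

theorem norm_iterate_cpartialD_le {U : Set (EuclideanSpace ℂ (Fin d))} (hU : IsOpen U)
    {G : EuclideanSpace ℂ (Fin d) → ℂ} (hG : AnalyticOnNhd ℂ G U) (n : Fin d)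
    {c : EuclideanSpace ℂ (Fin d)} {r ε M : ℝ} (hε : 0 < ε)
    (hsub : Metric.closedBall c r ⊆ U) (hM : ∀ z ∈ Metric.closedBall c r, ‖G z‖ ≤ M) (k : ℕ)
    (z : EuclideanSpace ℂ (Fin d)) (hz : z ∈ Metric.closedBall c (r - ε)) :
    ‖((cpartialD n)^[k] G) z‖ ≤ k.factorial * M / ε ^ k := by
  have hmem : ∀ w ∈ Metric.closedBall (0 : ℂ) ε,
      z + w • (EuclideanSpace.single n 1 : EuclideanSpace ℂ (Fin d)) ∈ Metric.closedBall c r := by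
    intro w hw
    rw [mem_closedBall_zero_iff] at hw
    rw [mem_closedBall_iff_norm] at hz ⊢
    calc _ = ‖(z - c) + w • (EuclideanSpace.single n 1 : EuclideanSpace ℂ (Fin d))‖ := by
          congr 1; abel
      _ ≤ ‖z - c‖ + ‖w • (EuclideanSpace.single n 1 : EuclideanSpace ℂ (Fin d))‖ := norm_add_le _ _
      _ ≤ (r - ε) + ε := by
          gcongr
          simpa [norm_smul] using hw
      _ = r := by ring
  have h0 := iteratedDeriv_line hU hG n z k 0
    (hsub (hmem 0 (Metric.mem_closedBall_self hε.le)))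
  rw [zero_smul, add_zero] at h0
  rw [← h0]
  refine Complex.norm_iteratedDeriv_le_of_forall_mem_sphere_norm_le k hε ?_ fun w hw =>
    hM _ (hmem w (Metric.sphere_subset_closedBall hw))
  apply DifferentiableOn.diffContOnCl
  rw [closure_ball _ hε.ne']
  intro w hw
  have h1 := (hG _ (hsub (hmem w hw))).differentiableAt
  exact (h1.comp w (hasDerivAt_line z _ w).differentiableAt).differentiableWithinAt

/-- One Cauchy estimate per variable, each on a ball whose radius has shrunk by ε. -/
theorem norm_foldr_cpartialD_le {U : Set (EuclideanSpace ℂ (Fin d))} (hU : IsOpen U)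
    {G : EuclideanSpace ℂ (Fin d) → ℂ} (hG : AnalyticOnNhd ℂ G U) (m : MIdx d)
    {c : EuclideanSpace ℂ (Fin d)} {r ε M : ℝ} (hε : 0 < ε)
    (hsub : Metric.closedBall c r ⊆ U) (hM : ∀ z ∈ Metric.closedBall c r, ‖G z‖ ≤ M)
    (L : List (Fin d)) :
    AnalyticOnNhd ℂ (L.foldr (fun n g => (cpartialD n)^[m n] g) G) U ∧
    ∀ z ∈ Metric.closedBall c (r - L.length * ε),
      ‖L.foldr (fun n g => (cpartialD n)^[m n] g) G z‖
        ≤ M * (L.map fun n => ((m n).factorial : ℝ) * (1 / ε) ^ m n).prod := by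
  induction L with
  | nil => exact ⟨hG, by simpa using hM⟩
  | cons n L ih =>
    refine ⟨analyticOnNhd_iterate_cpartialD ih.1 n _, fun z hz => ?_⟩
    rw [List.foldr_cons, List.map_cons, List.prod_cons]
    have hsub' : Metric.closedBall c (r - L.length * ε) ⊆ Metric.closedBall c r :=
      Metric.closedBall_subset_closedBall (by
        have : (0 : ℝ) ≤ L.length * ε := by positivity
        linarith)
    refine (norm_iterate_cpartialD_le hU ih.1 n hε (hsub'.trans hsub) ih.2 (m n) z ?_).trans
      (le_of_eq ?_)
    · convert hz using 2
      push_cast [List.length_cons]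
      ring
    · rw [one_div, inv_pow]
      ring

/-- The embedding of `ℝ^d` into `ℂ^d` as a linear map. -/
def complexifyCLM (d : ℕ) : Conf d →L[ℝ] EuclideanSpace ℂ (Fin d) :=
  LinearMap.toContinuousLinearMap
    { toFun := complexify
      map_add' := fun x y => by ext n; simp [complexify]
      map_smul' := fun r x => by ext n; simp [complexify] }

theorem complexifyCLM_apply (x : Conf d) : complexifyCLM d x = complexify x := rfl

theorem complexifyCLM_single (n : Fin d) :
    complexifyCLM d (EuclideanSpace.single n 1) = EuclideanSpace.single n 1 := by
  ext k
  by_cases h : k = n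
  · subst h; simp [complexifyCLM_apply, complexify]
  · simp [complexifyCLM_apply, complexify, h]

theorem norm_complexify (x : Conf d) : ‖complexify x‖ = ‖x‖ := by
  simp [EuclideanSpace.norm_eq, complexify]

theorem cpartialD_complexify {G : EuclideanSpace ℂ (Fin d) → ℂ} {f : Conf d → ℝ}
    (hf : ∀ x, G (complexify x) = (f x : ℂ)) (n : Fin d) (x : Conf d)
    (hG : DifferentiableAt ℂ G (complexify x)) :
    cpartialD n G (complexify x) = ((partialD n f x : ℝ) : ℂ) := by
  have h1 : HasFDerivAt (fun x => G (complexify x))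
      (((fderiv ℂ G (complexify x)).restrictScalars ℝ) ∘L complexifyCLM d) x :=
    (hG.hasFDerivAt.restrictScalars ℝ).comp x (complexifyCLM d).hasFDerivAt
  have h2 : HasFDerivAt f (Complex.reCLM ∘L
      (((fderiv ℂ G (complexify x)).restrictScalars ℝ) ∘L complexifyCLM d)) x := by
    refine (Complex.reCLM.hasFDerivAt.comp x h1).congr_of_eventuallyEq
      (Filter.Eventually.of_forall fun y => ?_)
    simp [hf]
  have h3 : HasFDerivAt (fun x => G (complexify x)) (Complex.ofRealCLM ∘L fderiv ℝ f x) x := by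
    refine (Complex.ofRealCLM.hasFDerivAt.comp x h2.differentiableAt.hasFDerivAt).congr_of_eventuallyEq
      (Filter.Eventually.of_forall fun y => ?_)
    simp [hf]
  have h4 := congrArg (fun D : Conf d →L[ℝ] ℂ => D (EuclideanSpace.single n 1)) (h1.unique h3)
  simp only [ContinuousLinearMap.comp_apply, complexifyCLM_single] at h4
  exact h4

theorem foldr_cpartialD_complexify {U : Set (EuclideanSpace ℂ (Fin d))}
    (hU : ∀ x : Conf d, complexify x ∈ U)
    {G : EuclideanSpace ℂ (Fin d) → ℂ} (hG : AnalyticOnNhd ℂ G U) {f : Conf d → ℝ}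
    (hf : ∀ x, G (complexify x) = (f x : ℂ)) (m : MIdx d) (L : List (Fin d)) :
    AnalyticOnNhd ℂ (L.foldr (fun n g => (cpartialD n)^[m n] g) G) U ∧
    ∀ x, L.foldr (fun n g => (cpartialD n)^[m n] g) G (complexify x)
      = ((L.foldr (fun n g => (partialD n)^[m n] g) f x : ℝ) : ℂ) := by
  induction L with
  | nil => exact ⟨hG, hf⟩
  | cons n L ih =>
    refine ⟨analyticOnNhd_iterate_cpartialD ih.1 n _, ?_⟩
    rw [List.foldr_cons, List.foldr_cons]
    generalize m n = k
    induction k with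
    | zero => exact ih.2
    | succ k ihk =>
      intro x
      rw [Function.iterate_succ_apply', Function.iterate_succ_apply']
      exact cpartialD_complexify ihk n x
        ((analyticOnNhd_iterate_cpartialD ih.1 n k) _ (hU x)).differentiableAt

theorem complexify_mem_strip {δ : ℝ} (hδ : 0 < δ) (x : Conf d) : complexify x ∈ strip d δ := by
  intro n
  simpa [complexify] using hδ.le

/-- Uniform Cauchy estimates for the Taylor coefficients of a potential with an analytic extension
to a strip. -/
theorem exists_taylor_bound {V : Conf d → ℝ} {δ M τ : ℝ} (hδ : 0 < δ) (hM : 0 < M)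
    (hτ : 0 < τ) (hV : HasStripExtension V δ M τ) (R : ℝ) :
    ∃ C > 0, ∃ r > 0, ∀ a : Conf d, ‖a‖ ≤ R → ∀ m : MIdx d,
      |multiD m V a / (mfact m : ℝ)| ≤ C * r ^ order m := by
  obtain ⟨U, F, hU, hsU, hF, hFV, hb⟩ := hV
  -- The d successive estimates use up radius d ε < δ, so the real centre is still inside the last
  -- ball.
  set ε := δ / (d + 1) with hε
  have hε0 : 0 < ε := by positivity
  refine ⟨M * Real.exp (τ * (|R| + δ) ^ 2), by positivity, 1 / ε, by positivity,
    fun a ha m => ?_⟩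
  have hball : Metric.closedBall (complexify a) δ ⊆ strip d δ := by
    intro z hz n
    rw [mem_closedBall_iff_norm] at hz
    have h1 : (z n).im = ((z - complexify a) n).im := by simp [complexify]
    rw [h1]
    exact (Complex.abs_im_le_norm _).trans ((PiLp.norm_apply_le _ n).trans hz)
  have hbd : ∀ z ∈ Metric.closedBall (complexify a) δ,
      ‖F z‖ ≤ M * Real.exp (τ * (|R| + δ) ^ 2) := by
    intro z hz
    refine (hb z (hball hz)).trans ?_
    rw [mem_closedBall_iff_norm] at hz
    have h1 : ‖z‖ ≤ |R| + δ := by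
      calc ‖z‖ = ‖complexify a + (z - complexify a)‖ := by congr 1; abel
        _ ≤ ‖complexify a‖ + ‖z - complexify a‖ := norm_add_le _ _
        _ ≤ |R| + δ := by
          rw [norm_complexify]
          exact add_le_add (ha.trans (le_abs_self R)) hz
    gcongr
  have h1 := (norm_foldr_cpartialD_le hU hF m hε0 (hball.trans hsU) hbd (List.finRange d)).2
    (complexify a) (Metric.mem_closedBall_self (by
      rw [List.length_finRange, hε]
      have : (d : ℝ) * (δ / (d + 1)) = δ * (d / (d + 1)) := by ring
      rw [this]
      have h2 : (d : ℝ) / (d + 1) ≤ 1 := by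
        rw [div_le_one (by positivity)]
        linarith
      nlinarith))
  rw [(foldr_cpartialD_complexify (fun x => hsU (complexify_mem_strip hδ x)) hF hFV m
    (List.finRange d)).2 a] at h1
  have h2 : ((List.finRange d).map fun n => ((m n).factorial : ℝ) * (1 / ε) ^ m n).prod
      = (mfact m : ℝ) * (1 / ε) ^ order m := by
    rw [← List.ofFn_eq_map, List.prod_ofFn, Finset.prod_mul_distrib, Finset.prod_pow_eq_pow_sum]
    simp [mfact, order]
  rw [h2, Complex.norm_real] at h1
  have h3 : (0 : ℝ) < mfact m := by exact_mod_cast mfact_pos m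
  rw [abs_div, abs_of_pos h3, div_le_iff₀ h3]
  calc |multiD m V a| ≤ _ := h1
    _ = _ := by ring

theorem contDiff_of_hasStripExtension {V : Conf d → ℝ} {δ M τ : ℝ} (hδ : 0 < δ)
    (hV : HasStripExtension V δ M τ) : ContDiff ℝ 2 V := by
  obtain ⟨U, F, hU, hsU, hF, hFV, hb⟩ := hV
  have h1 : V = fun x => Complex.reCLM (F (complexifyCLM d x)) := by
    ext x
    simp [complexifyCLM_apply, hFV]
  rw [h1, contDiff_iff_contDiffAt]
  intro x
  have h2 : ContDiffAt ℝ 2 F (complexifyCLM d x) :=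
    ((hF _ (hsU (complexify_mem_strip hδ x))).contDiffAt).restrict_scalars ℝ
  exact Complex.reCLM.contDiff.contDiffAt.comp x
    (h2.comp x (complexifyCLM d).contDiff.contDiffAt)

theorem hessian_symm {V : Conf d → ℝ} (hV : ContDiff ℝ 2 V) (x : Conf d) (i j : Fin d) :
    hessian V x i j = hessian V x j i := by
  have hsym : IsSymmSndFDerivAt ℝ V x := hV.contDiffAt.isSymmSndFDerivAt (by simp)
  have hd : Differentiable ℝ (fderiv ℝ V) :=
    (hV.fderiv_right (m := 1) (by norm_num)).differentiable (by norm_num)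
  have h1 : ∀ i j, hessian V x i j = fderiv ℝ (fderiv ℝ V) x (EuclideanSpace.single i 1)
      (EuclideanSpace.single j 1) := fun i j => by
    change fderiv ℝ (fun y => fderiv ℝ V y (EuclideanSpace.single j 1)) x
      (EuclideanSpace.single i 1) = _
    rw [fderiv_clm_apply (hd x) (differentiableAt_const _)]
    simp
  rw [h1, h1, hsym.eq]

/-! ### The classical flow -/

-- If A v = 0, the form v^*(A^*B + B^*A)v vanishes, yet it equals 2|v|².
open scoped ComplexOrder in
theorem isUnit_det_of_herm {A B : Matrix (Fin d) (Fin d) ℂ}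
    (h : Aᴴ * B + Bᴴ * A = (2 : ℂ) • (1 : Matrix (Fin d) (Fin d) ℂ)) : IsUnit A.det := by
  rw [isUnit_iff_ne_zero]
  intro h0
  obtain ⟨v, hv, hAv⟩ := Matrix.exists_mulVec_eq_zero_iff.2 h0
  have h1 : star v ⬝ᵥ ((Aᴴ * B + Bᴴ * A) *ᵥ v) = 0 := by
    rw [Matrix.add_mulVec, ← Matrix.mulVec_mulVec, ← Matrix.mulVec_mulVec, hAv,
      Matrix.mulVec_zero, add_zero, Matrix.dotProduct_mulVec, ← Matrix.star_mulVec, hAv]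
    simp
  rw [h, Matrix.smul_mulVec, Matrix.one_mulVec, dotProduct_smul] at h1
  have h2 : star v ⬝ᵥ v = 0 := by simpa using h1
  exact hv (dotProduct_star_self_eq_zero.1 h2)

theorem eq_init_of_hasDerivWithinAt_zero {T : ℝ} {f : ℝ → ℂ}
    (hf : ∀ t ∈ Set.Icc 0 T, HasDerivWithinAt f 0 (Set.Icc 0 T) t) :
    ∀ t ∈ Set.Icc 0 T, f t = f 0 := by
  intro t ht
  refine constant_of_derivWithin_zero (fun x hx => (hf x hx).differentiableWithinAt)
    (fun x hx => ?_) t ht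
  have hx' : x ∈ Set.Icc 0 T := ⟨hx.1, hx.2.le⟩
  exact (hf x hx').derivWithin (uniqueDiffOn_Icc (lt_of_le_of_lt hx.1 hx.2) x hx')

namespace IsClassicalFlow

variable {V : Conf d → ℝ} {T : ℝ} {p : ℝ → PacketData d} {S : ℝ → ℝ}

/-- Both matrix expressions are constants of the motion: in their derivatives the B-terms cancel,
and the Hessian terms cancel because the Hessian is real and symmetric. Invertibility then follows
from the second relation. -/
theorem admissible (hflow : IsClassicalFlow V T p S) (hV : ContDiff ℝ 2 V) {t : ℝ}
    (ht : t ∈ Set.Icc 0 T) : Admissible (p t).A (p t).B := by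
  set H : ℝ → Matrix (Fin d) (Fin d) ℂ := fun t => (hessian V (p t).a).map (fun y : ℝ => (y : ℂ))
    with hH
  have hHs : ∀ t i j, H t i j = H t j i := fun t i j => by
    simp only [hH, Matrix.map_apply, hessian_symm hV]
  have hHT : ∀ t, (H t)ᵀ = H t := fun t => by
    ext i j
    rw [Matrix.transpose_apply, hHs]
  have hHH : ∀ t, (H t)ᴴ = H t := fun t => by
    ext i j
    rw [Matrix.conjTranspose_apply, hHs]
    simp [hH]
  have hA := hflow.deriv_A
  have hB := hflow.deriv_B
  have hconj : ∀ {f : ℝ → ℂ} {f' : ℂ} {t : ℝ}, HasDerivWithinAt f f' (Set.Icc 0 T) t →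
      HasDerivWithinAt (fun t => conj (f t)) (conj f') (Set.Icc 0 T) t := fun h => h.star
  have hsymm : (p t).Aᵀ * (p t).B - (p t).Bᵀ * (p t).A = 0 := by
    rw [← hflow.init.symm]
    ext i j
    refine eq_init_of_hasDerivWithinAt_zero
      (f := fun t => ((p t).Aᵀ * (p t).B - (p t).Bᵀ * (p t).A) i j) (fun s hs => ?_) t ht
    simp only [Matrix.sub_apply, Matrix.mul_apply, Matrix.transpose_apply]
    refine ((HasDerivWithinAt.fun_sum fun k _ => (hA s hs k i).fun_mul (hB s hs k j)).fun_sub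
      (HasDerivWithinAt.fun_sum fun k _ => (hB s hs k i).fun_mul (hA s hs k j))).congr_deriv ?_
    have h1 : (((p s).Aᵀ * (H s * (p s).A)) - (H s * (p s).A)ᵀ * (p s).A) i j = 0 := by
      rw [Matrix.transpose_mul, hHT, Matrix.mul_assoc, sub_self]
      rfl
    simp only [Matrix.sub_apply] at h1
    rw [Matrix.mul_apply, Matrix.mul_apply] at h1
    simp only [Matrix.transpose_apply] at h1
    rw [← Finset.sum_sub_distrib] at h1 ⊢
    rw [← mul_zero Complex.I, ← h1, Finset.mul_sum]
    exact Finset.sum_congr rfl fun k _ => by ring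
  have hherm : (p t).Aᴴ * (p t).B + (p t).Bᴴ * (p t).A
      = (2 : ℂ) • (1 : Matrix (Fin d) (Fin d) ℂ) := by
    rw [← hflow.init.herm]
    ext i j
    refine eq_init_of_hasDerivWithinAt_zero
      (f := fun t => ((p t).Aᴴ * (p t).B + (p t).Bᴴ * (p t).A) i j) (fun s hs => ?_) t ht
    simp only [Matrix.add_apply, Matrix.mul_apply, Matrix.conjTranspose_apply]
    refine ((HasDerivWithinAt.fun_sum fun k _ => (hconj (hA s hs k i)).fun_mul (hB s hs k j)).fun_add
      (HasDerivWithinAt.fun_sum fun k _ =>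
        (hconj (hB s hs k i)).fun_mul (hA s hs k j))).congr_deriv ?_
    have h1 : (((p s).Aᴴ * (H s * (p s).A)) - (H s * (p s).A)ᴴ * (p s).A) i j = 0 := by
      rw [Matrix.conjTranspose_mul, hHH, Matrix.mul_assoc, sub_self]
      rfl
    simp only [Matrix.sub_apply] at h1
    rw [Matrix.mul_apply, Matrix.mul_apply] at h1
    simp only [Matrix.conjTranspose_apply] at h1
    rw [← Finset.sum_sub_distrib] at h1
    rw [← Finset.sum_add_distrib, ← mul_zero Complex.I, ← h1, Finset.mul_sum]
    refine Finset.sum_congr rfl fun k _ => ?_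
    simp only [map_mul, Complex.conj_I, RCLike.star_def]
    ring
  exact ⟨isUnit_det_of_herm hherm, isUnit_det_of_herm (by rw [add_comm]; exact hherm), hsymm, hherm⟩

theorem exists_bound_A (hflow : IsClassicalFlow V T p S) :
    ∃ K > 0, ∀ t ∈ Set.Icc 0 T, ∀ i j, ‖(p t).A i j‖ ≤ K := by
  have h1 : ∀ i j, ∃ K, ∀ t ∈ Set.Icc 0 T, ‖(p t).A i j‖ ≤ K := fun i j =>
    isCompact_Icc.exists_bound_of_continuousOn fun t ht =>
      (hflow.deriv_A t ht i j).continuousWithinAt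
  choose K hK using h1
  refine ⟨∑ i, ∑ j, |K i j| + 1, by positivity, fun t ht i j => ?_⟩
  have h2 : |K i j| ≤ ∑ j, |K i j| :=
    Finset.single_le_sum (f := fun j => |K i j|) (fun _ _ => abs_nonneg _) (Finset.mem_univ j)
  have h3 : ∑ j, |K i j| ≤ ∑ i, ∑ j, |K i j| :=
    Finset.single_le_sum (f := fun i => ∑ j, |K i j|)
      (fun _ _ => Finset.sum_nonneg fun _ _ => abs_nonneg _) (Finset.mem_univ i)
  linarith [hK i j t ht, le_abs_self (K i j)]

theorem exists_bound_a (hflow : IsClassicalFlow V T p S) :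
    ∃ R, ∀ t ∈ Set.Icc 0 T, ‖(p t).a‖ ≤ R :=
  isCompact_Icc.exists_bound_of_continuousOn fun t ht => (hflow.deriv_a t ht).continuousWithinAt

theorem exists_bound_rootDet (hflow : IsClassicalFlow V T p S) (hV : ContDiff ℝ 2 V) :
    ∃ K > 0, ∀ t ∈ Set.Icc 0 T, ‖(p t).rootDet‖⁻¹ ≤ K := by
  have hne : ∀ t ∈ Set.Icc 0 T, (p t).rootDet ≠ 0 := fun t ht h0 => by
    have := hflow.root_sq t ht
    rw [h0] at this
    have h1 := (hflow.admissible hV ht).unit_A.ne_zero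
    exact h1 (by rw [← this]; simp)
  obtain ⟨K, hK⟩ := isCompact_Icc.exists_bound_of_continuousOn
    (f := fun t => ((p t).rootDet)⁻¹) (hflow.root_cont.inv₀ hne)
  refine ⟨|K| + 1, by positivity, fun t ht => ?_⟩
  rw [← norm_inv]
  linarith [hK t ht, le_abs_self K]

end IsClassicalFlow

/-! ### Matrix elements of the position and of the potential -/

theorem eval_prod_posPoly {p : PacketData d} (hp : Admissible p.A p.B) {h : ℝ} (hh : 0 < h)
    (m : MIdx d) (x : Conf d) :
    MvPolynomial.eval (cplxCoord p h x) (∏ n, posPoly p.A n ^ m n)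
      = ((h ^ (-(order m : ℝ) / 2) * monomial m p.a x : ℝ) : ℂ) := by
  have h1 : h ^ (-(order m : ℝ) / 2) = ((Real.sqrt h)⁻¹) ^ order m := by
    rw [Real.sqrt_eq_rpow, ← Real.rpow_neg hh.le, ← Real.rpow_natCast, ← Real.rpow_mul hh.le]
    congr 1
    ring
  rw [map_prod, h1, order, ← Finset.prod_pow_eq_pow_sum, monomial, ← Finset.prod_mul_distrib]
  push_cast
  refine Finset.prod_congr rfl fun n _ => ?_
  rw [map_pow, eval_posPoly hp hh, ← mul_pow]
  push_cast
  ring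

theorem Xmat_eq_packetInner {p : PacketData d} (hp : Admissible p.A p.B) {h : ℝ} (hh : 0 < h)
    (m j i : MIdx d) :
    Xmat p h m j i = packetInner p h (hermPoly (shearMat p.A) j)
      ((∏ n, posPoly p.A n ^ m n) * hermPoly (shearMat p.A) i) := by
  rw [Xmat, packetInner, ← integral_const_mul]
  congr 1
  ext x
  rw [polyPacket_mul, eval_prod_posPoly hp hh, phi_eq_polyPacket hp hh, phi_eq_polyPacket hp hh]
  push_cast
  ring

theorem card_idxEq_le (d k : ℕ) : (idxEq d k).card ≤ d ^ k := by
  have h1 := Finset.sum_pow_eq_sum_piAntidiag (Finset.univ : Finset (Fin d)) (fun _ => (1 : ℕ)) k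
  simp only [Finset.sum_const, Finset.card_univ, Fintype.card_fin, smul_eq_mul, mul_one,
    one_pow, Finset.prod_const_one] at h1
  rw [h1, idxEq, Finset.card_eq_sum_ones]
  exact Finset.sum_le_sum fun m _ => Nat.multinomial_pos _ _

section Kmat

variable {V : Conf d → ℝ} {p : PacketData d} {h K : ℝ}

/-- Multiplication by (x − a)^m with |m| = k raises the order by at most k, and states of higher
order are orthogonal to the result. -/
theorem Kmat_eq_zero (hp : Admissible p.A p.B) (hh : 0 < h) (k : ℕ) (j i : MIdx d)
    (hji : order i + k < order j) : Kmat V p h k j i = 0 := by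
  obtain ⟨K, hK⟩ := exists_norm_entry_le p.A
  refine Finset.sum_eq_zero fun m hm => ?_
  rw [mem_idxEq] at hm
  have h1 := (HasExpansion.hermPoly (S := shearMat p.A) i).prod_posPoly_mul hp.shearMat_symm
    hp.mul_shearMat (K := |K|) (fun i j => (hK i j).trans (le_abs_self K)) (abs_nonneg _) m
  rw [Xmat_eq_packetInner hp hh, h1.packetInner_eq_zero hp hh j (by omega), mul_zero]

/-- The three factors to the power k come from the number of multi-indices of order k (at most d^k),
the Taylor coefficients (r^k), and the k position factors. -/
theorem sum_norm_Kmat_le (hp : Admissible p.A p.B) (hh : 0 < h) (hK0 : 0 ≤ K)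
    (hK : ∀ i j, ‖p.A i j‖ ≤ K) {Z C r : ℝ} (hZ : ‖packetInner p h 1 1‖ ≤ Z)
    (hC : 0 ≤ C) (hr : 0 ≤ r)
    (hV : ∀ m : MIdx d, |multiD m V p.a / (mfact m : ℝ)| ≤ C * r ^ order m)
    (k : ℕ) (i : MIdx d) (s : Finset (MIdx d)) :
    ∑ j ∈ s, ‖Kmat V p h k j i‖
      ≤ C * Z * (d * r * (2 * d * K) * Real.sqrt (order i + k)) ^ k := by
  have hZ0 : 0 ≤ Z := (norm_nonneg _).trans hZ
  have h1 : ∀ m ∈ idxEq d k, ∑ j ∈ s,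
      ‖((multiD m V p.a / (mfact m : ℝ) : ℝ) : ℂ) * Xmat p h m j i‖
      ≤ (C * r ^ k) * (Z * (2 * d * K * Real.sqrt (order i + k)) ^ k) := by
    intro m hm
    rw [mem_idxEq] at hm
    have h2 := (HasExpansion.hermPoly (S := shearMat p.A) i).prod_posPoly_mul hp.shearMat_symm
      hp.mul_shearMat hK hK0 m
    have h3 := h2.sum_norm_packetInner_le hp hh s
    simp only [norm_mul, Complex.norm_real, Real.norm_eq_abs, ← Finset.mul_sum,
      Xmat_eq_packetInner hp hh]
    rw [hm, mul_one] at h3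
    have h4 := hV m
    rw [hm] at h4
    refine mul_le_mul h4 (h3.trans ?_) (Finset.sum_nonneg fun _ _ => norm_nonneg _) (by positivity)
    exact mul_le_mul_of_nonneg_right hZ (by positivity)
  calc ∑ j ∈ s, ‖Kmat V p h k j i‖
      ≤ ∑ j ∈ s, ∑ m ∈ idxEq d k,
        ‖((multiD m V p.a / (mfact m : ℝ) : ℝ) : ℂ) * Xmat p h m j i‖ :=
        Finset.sum_le_sum fun j _ => norm_sum_le _ _
    _ = ∑ m ∈ idxEq d k, ∑ j ∈ s,
        ‖((multiD m V p.a / (mfact m : ℝ) : ℝ) : ℂ) * Xmat p h m j i‖ := Finset.sum_comm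
    _ ≤ (idxEq d k).card • ((C * r ^ k) * (Z * (2 * d * K * Real.sqrt (order i + k)) ^ k)) :=
        Finset.sum_le_card_nsmul _ _ _ h1
    _ ≤ (d : ℝ) ^ k * ((C * r ^ k) * (Z * (2 * d * K * Real.sqrt (order i + k)) ^ k)) := by
        rw [nsmul_eq_mul]
        refine mul_le_mul_of_nonneg_right ?_ (by positivity)
        exact_mod_cast card_idxEq_le d k
    _ = _ := by
        simp only [mul_pow]
        ring

end Kmat

/-! ### Growth of the coefficients -/

theorem sum_norm_intervalIntegral_le {ι : Type*} (s : Finset ι) (f : ι → ℝ → ℂ) {g : ℝ → ℝ} {t : ℝ}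
    (ht : 0 ≤ t) (hg : IntervalIntegrable g volume 0 t)
    (hfg : ∀ x ∈ Set.Icc 0 t, ∑ i ∈ s, ‖f i x‖ ≤ g x) :
    ∑ i ∈ s, ‖∫ x in (0 : ℝ)..t, f i x‖ ≤ ∫ x in (0 : ℝ)..t, g x := by
  classical
  -- An integral of a non-integrable function is 0 by convention, so such indices drop out and no
  -- regularity in time of the integrands is needed.
  set s' := s.filter fun i => IntervalIntegrable (f i) volume 0 t with hs'
  have hint : ∀ i ∈ s', IntervalIntegrable (fun x => ‖f i x‖) volume 0 t := fun i hi =>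
    (Finset.mem_filter.1 hi).2.norm
  have h1 : ∑ i ∈ s, ‖∫ x in (0 : ℝ)..t, f i x‖ = ∑ i ∈ s', ‖∫ x in (0 : ℝ)..t, f i x‖ := by
    rw [hs', Finset.sum_filter]
    refine Finset.sum_congr rfl fun i _ => ?_
    split_ifs with hi
    · rfl
    · rw [intervalIntegral.integral_undef hi, norm_zero]
  rw [h1]
  calc _ ≤ ∑ i ∈ s', ∫ x in (0 : ℝ)..t, ‖f i x‖ :=
        Finset.sum_le_sum fun i _ => intervalIntegral.norm_integral_le_integral_norm ht
    _ = ∫ x in (0 : ℝ)..t, ∑ i ∈ s', ‖f i x‖ :=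
        (intervalIntegral.integral_finsetSum hint).symm
    _ ≤ _ := by
        have h2 : IntervalIntegrable (fun x => ∑ i ∈ s', ‖f i x‖) volume 0 t := by
          simpa [Finset.sum_fn] using IntervalIntegrable.sum s' hint
        refine intervalIntegral.integral_mono_on ht h2 hg fun x hx => le_trans ?_ (hfg x hx)
        exact Finset.sum_le_sum_of_subset_of_nonneg (Finset.filter_subset _ _)
          fun _ _ _ => norm_nonneg _

section coeff

variable {V : Conf d → ℝ} {T : ℝ} {p : ℝ → PacketData d} {h : ℝ} {J : ℕ} {c₀ : MIdx d → ℂ}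

theorem coeff_zero (t : ℝ) (j : MIdx d) : coeff V p h c₀ 0 t j = c₀ j := by
  rw [coeff]
  simp

theorem coeff_of_pos {n : ℕ} (hn : 0 < n) (t : ℝ) (j : MIdx d) :
    coeff V p h c₀ n t j = -Complex.I * ∫ s in (0 : ℝ)..t, ∑ k : Fin n, ∑' i : MIdx d,
      Kmat V (p s) h (n + 2 - (k : ℕ)) j i * coeff V p h c₀ (k : ℕ) s i := by
  rw [coeff]
  simp [hn.ne']

/-- Each source term K_{n+2−k} c_k reaches order at most J + 3k + (n + 2 − k), which is at most J +
3n because k < n. -/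
theorem coeff_eq_zero (hsupp : ∀ j, J < order j → c₀ j = 0)
    (hK0 : ∀ t ∈ Set.Icc 0 T, ∀ k j i, order i + k < order j → Kmat V (p t) h k j i = 0) (n : ℕ) :
    ∀ t ∈ Set.Icc 0 T, ∀ j, J + 3 * n < order j → coeff V p h c₀ n t j = 0 := by
  induction n using Nat.strong_induction_on with
  | _ n ih =>
    intro t ht j hj
    rcases Nat.eq_zero_or_pos n with rfl | hn
    · rw [coeff_zero]
      exact hsupp j (by omega)
    · rw [coeff_of_pos hn]
      have : ∫ s in (0 : ℝ)..t, ∑ k : Fin n, ∑' i : MIdx d,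
          Kmat V (p s) h (n + 2 - (k : ℕ)) j i * coeff V p h c₀ (k : ℕ) s i
          = ∫ s in (0 : ℝ)..t, (0 : ℂ) := by
        refine intervalIntegral.integral_congr fun s hs => ?_
        rw [Set.uIcc_of_le ht.1] at hs
        have hs' : s ∈ Set.Icc 0 T := ⟨hs.1, hs.2.trans ht.2⟩
        refine Finset.sum_eq_zero fun k _ => ?_
        rw [← tsum_zero (α := ℂ) (β := MIdx d)]
        refine tsum_congr fun i => ?_
        have hk := k.2
        by_cases hi : J + 3 * (k : ℕ) < order i
        · rw [ih k hk s hs' i hi, mul_zero]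
        · rw [hK0 s hs' _ j i (by omega), zero_mul]
      rw [this]
      simp

/-- The horizon N is fixed before the induction, so that one rate ω = C ν² N serves every n ≤ N. The
factor 2^n in the bound pays for the sum over k < n, and the exponential pays for the integration in
time. -/
theorem sum_norm_coeff_le (hsupp : ∀ j, J < order j → c₀ j = 0)
    (hK0 : ∀ t ∈ Set.Icc 0 T, ∀ k j i, order i + k < order j → Kmat V (p t) h k j i = 0)
    {C κ : ℝ} (hC : 0 < C) (hκ : 0 < κ)
    (hKb : ∀ t ∈ Set.Icc 0 T, ∀ k i (s : Finset (MIdx d)),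
      ∑ j ∈ s, ‖Kmat V (p t) h k j i‖ ≤ C * (κ * Real.sqrt (order i + k)) ^ k)
    (N : ℕ) (hN : 1 ≤ N) (n : ℕ) (hnN : n ≤ N) :
    ∀ t ∈ Set.Icc 0 T, ∀ s : Finset (MIdx d), ∑ j ∈ s, ‖coeff V p h c₀ n t j‖ ≤
      (∑ j ∈ idxLe d J, ‖c₀ j‖) * (2 * (κ * Real.sqrt (J + 3)) * Real.sqrt N) ^ n
        * Real.exp (C * (κ * Real.sqrt (J + 3)) ^ 2 * N * t) := by
  set D := ∑ j ∈ idxLe d J, ‖c₀ j‖ with hD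
  have hD0 : 0 ≤ D := Finset.sum_nonneg fun _ _ => norm_nonneg _
  set ν := κ * Real.sqrt (J + 3) with hν
  have hν0 : 0 < ν := by positivity
  have hN0 : (0 : ℝ) < N := by exact_mod_cast hN
  set ω := C * ν ^ 2 * N with hω
  have hω0 : 0 < ω := by positivity
  induction n using Nat.strong_induction_on with
  | _ n ih =>
    intro t ht s
    rcases Nat.eq_zero_or_pos n with rfl | hn
    · simp only [coeff_zero, pow_zero, mul_one]
      refine le_trans ?_ (le_mul_of_one_le_right hD0
        (Real.one_le_exp (mul_nonneg hω0.le ht.1)))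
      rw [← Finset.sum_filter_add_sum_filter_not s (fun j => order j ≤ J)]
      have h1 : ∑ j ∈ s.filter (fun j => ¬ order j ≤ J), ‖c₀ j‖ = 0 :=
        Finset.sum_eq_zero fun j hj => by
          rw [hsupp j (not_le.1 (Finset.mem_filter.1 hj).2), norm_zero]
      rw [h1, add_zero]
      exact Finset.sum_le_sum_of_subset_of_nonneg
        (fun j hj => mem_idxLe.2 (Finset.mem_filter.1 hj).2) fun _ _ _ => norm_nonneg _
    · set f : MIdx d → ℝ → ℂ := fun j s => ∑ k : Fin n, ∑' i : MIdx d,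
        Kmat V (p s) h (n + 2 - (k : ℕ)) j i * coeff V p h c₀ (k : ℕ) s i with hf
      -- Here 2^n − 1 is ∑_{k<n} 2^k, and the integral of ω exp(ωx) is exp(ωt) − 1, so no factor ω
      -- survives the integration.
      set g : ℝ → ℝ := fun x => D * (ν * Real.sqrt N) ^ n * (2 ^ n - 1) * (ω * Real.exp (ω * x))
        with hg
      have h1 : ∀ x ∈ Set.Icc 0 t, ∑ j ∈ s, ‖f j x‖ ≤ g x := by
        intro x hx
        have hx' : x ∈ Set.Icc 0 T := ⟨hx.1, hx.2.trans ht.2⟩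
        have h2 : ∀ k : Fin n, ∀ j, ∑' i : MIdx d,
            Kmat V (p x) h (n + 2 - (k : ℕ)) j i * coeff V p h c₀ (k : ℕ) x i
            = ∑ i ∈ idxLe d (J + 3 * k),
              Kmat V (p x) h (n + 2 - (k : ℕ)) j i * coeff V p h c₀ (k : ℕ) x i := fun k j => by
          refine tsum_eq_sum fun i hi => ?_
          rw [mem_idxLe, not_le] at hi
          rw [coeff_eq_zero hsupp hK0 k x hx' i hi, mul_zero]
        have h3 : ∀ k : Fin n, ∑ j ∈ s, ‖∑ i ∈ idxLe d (J + 3 * k),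
              Kmat V (p x) h (n + 2 - (k : ℕ)) j i * coeff V p h c₀ (k : ℕ) x i‖
            ≤ D * (ν * Real.sqrt N) ^ n * (ω * Real.exp (ω * x)) * 2 ^ (k : ℕ) := by
          intro k
          have hk := k.2
          obtain ⟨q, hq⟩ : ∃ q, n = k + q := ⟨n - k, by omega⟩
          have hq1 : 1 ≤ q := by omega
          have e1 : n + 2 - (k : ℕ) = q + 2 := by omega
          rw [e1]
          have h4 : ∀ i ∈ idxLe d (J + 3 * k),
              ∑ j ∈ s, ‖Kmat V (p x) h (q + 2) j i‖ ≤ ω * (ν * Real.sqrt N) ^ q := by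
            intro i hi
            rw [mem_idxLe] at hi
            refine (hKb x hx' (q + 2) i s).trans ?_
            have h5 : Real.sqrt (order i + (q + 2 : ℕ)) ≤ Real.sqrt (J + 3) * Real.sqrt N := by
              rw [← Real.sqrt_mul (by positivity)]
              apply Real.sqrt_le_sqrt
              -- From |i| ≤ J + 3k and q + 2 ≤ 3q, valid as q ≥ 1, the left side is at most J + 3(k
              -- + q) = J + 3n.
              have h6 : order i + (q + 2) ≤ (J + 3) * N := by
                have : J ≤ J * N := Nat.le_mul_of_pos_right J hN
                have e2 : (J + 3) * N = J * N + 3 * N := by ring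
                omega
              exact_mod_cast h6
            calc C * (κ * Real.sqrt (order i + (q + 2 : ℕ))) ^ (q + 2)
                ≤ C * (κ * (Real.sqrt (J + 3) * Real.sqrt N)) ^ (q + 2) := by gcongr
              _ = C * ν ^ 2 * (Real.sqrt N) ^ 2 * (ν * Real.sqrt N) ^ q := by
                  rw [← mul_assoc κ, ← hν]
                  ring
              _ = _ := by rw [Real.sq_sqrt hN0.le]
          calc _ ≤ ∑ j ∈ s, ∑ i ∈ idxLe d (J + 3 * k),
                ‖Kmat V (p x) h (q + 2) j i‖ * ‖coeff V p h c₀ (k : ℕ) x i‖ :=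
                Finset.sum_le_sum fun j _ => (norm_sum_le _ _).trans
                  (Finset.sum_le_sum fun i _ => norm_mul_le _ _)
            _ = ∑ i ∈ idxLe d (J + 3 * k),
                (∑ j ∈ s, ‖Kmat V (p x) h (q + 2) j i‖) * ‖coeff V p h c₀ (k : ℕ) x i‖ := by
                rw [Finset.sum_comm]
                exact Finset.sum_congr rfl fun i _ => (Finset.sum_mul _ _ _).symm
            _ ≤ ∑ i ∈ idxLe d (J + 3 * k),
                (ω * (ν * Real.sqrt N) ^ q) * ‖coeff V p h c₀ (k : ℕ) x i‖ :=
                Finset.sum_le_sum fun i hi =>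
                  mul_le_mul_of_nonneg_right (h4 i hi) (norm_nonneg _)
            _ ≤ (ω * (ν * Real.sqrt N) ^ q) *
                (D * (2 * ν * Real.sqrt N) ^ (k : ℕ) * Real.exp (ω * x)) := by
                rw [← Finset.mul_sum]
                exact mul_le_mul_of_nonneg_left (ih k hk (by omega) x hx' _) (by positivity)
            _ = _ := by
                have e2 : (ν * Real.sqrt N) ^ n
                    = (ν * Real.sqrt N) ^ (k : ℕ) * (ν * Real.sqrt N) ^ q := by
                  rw [← pow_add, ← hq]
                rw [e2, mul_assoc 2 ν, mul_pow 2]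
                ring
        calc ∑ j ∈ s, ‖f j x‖ ≤ ∑ j ∈ s, ∑ k : Fin n, ‖∑ i ∈ idxLe d (J + 3 * k),
              Kmat V (p x) h (n + 2 - (k : ℕ)) j i * coeff V p h c₀ (k : ℕ) x i‖ := by
              refine Finset.sum_le_sum fun j _ => ?_
              simp only [hf, h2]
              exact norm_sum_le _ _
          _ = ∑ k : Fin n, ∑ j ∈ s, ‖∑ i ∈ idxLe d (J + 3 * k),
              Kmat V (p x) h (n + 2 - (k : ℕ)) j i * coeff V p h c₀ (k : ℕ) x i‖ :=
              Finset.sum_comm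
          _ ≤ ∑ k : Fin n, D * (ν * Real.sqrt N) ^ n * (ω * Real.exp (ω * x)) * 2 ^ (k : ℕ) :=
              Finset.sum_le_sum fun k _ => h3 k
          _ = g x := by
              rw [← Finset.mul_sum, Fin.sum_univ_eq_sum_range (fun k => (2 : ℝ) ^ k) n,
                geom_sum_eq (by norm_num)]
              simp only [hg]
              ring
      have hgint : ∫ x in (0 : ℝ)..t, g x
          = D * (ν * Real.sqrt N) ^ n * (2 ^ n - 1) * (Real.exp (ω * t) - 1) := by
        simp only [hg]
        rw [intervalIntegral.integral_const_mul]
        congr 1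
        have hder : ∀ x ∈ Set.uIcc 0 t,
            HasDerivAt (fun x => Real.exp (ω * x)) (ω * Real.exp (ω * x)) x := fun x _ => by
          have := ((hasDerivAt_id x).const_mul ω).exp
          simpa [mul_comm] using this
        rw [intervalIntegral.integral_eq_sub_of_hasDerivAt hder
          (Continuous.intervalIntegrable (by fun_prop) _ _)]
        simp
      have h7 := sum_norm_intervalIntegral_le s f ht.1
        (Continuous.intervalIntegrable (by fun_prop) _ _) h1
      have h8 : ∑ j ∈ s, ‖coeff V p h c₀ n t j‖ = ∑ j ∈ s, ‖∫ x in (0 : ℝ)..t, f j x‖ := by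
        refine Finset.sum_congr rfl fun j _ => ?_
        rw [coeff_of_pos hn, norm_mul, norm_neg, Complex.norm_I, one_mul]
      rw [h8]
      refine h7.trans ?_
      have h2n : (1 : ℝ) ≤ 2 ^ n := one_le_pow₀ (by norm_num)
      have he : (1 : ℝ) ≤ Real.exp (ω * t) := Real.one_le_exp (mul_nonneg hω0.le ht.1)
      rw [hgint, mul_assoc 2 ν, mul_pow 2]
      calc _ ≤ D * (ν * Real.sqrt N) ^ n * 2 ^ n * Real.exp (ω * t) := by
            apply mul_le_mul _ (by linarith) (by linarith) (by positivity)
            apply mul_le_mul_of_nonneg_left (by linarith) (by positivity)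
        _ = _ := by ring

end coeff

/-! ### Exponential localization -/

/-- The power mean inequality, with d^{l−1} weakened to d^l. It replaces |x − a|^{2l} by powers of
single coordinates. -/
theorem norm_sq_pow_le (v : Conf d) {l : ℕ} (hl : 1 ≤ l) :
    (‖v‖ ^ 2) ^ l ≤ (d : ℝ) ^ l * ∑ n, ((v n) ^ 2) ^ l := by
  obtain ⟨k, rfl⟩ : ∃ k, l = k + 1 := ⟨l - 1, by omega⟩
  rw [EuclideanSpace.norm_sq_eq]
  simp only [Real.norm_eq_abs, sq_abs]
  rcases Nat.eq_zero_or_pos d with rfl | hd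
  · simp
  have h1 := pow_sum_div_card_le_sum_pow (s := (Finset.univ : Finset (Fin d)))
    (f := fun n => (v n) ^ 2) (fun _ _ => sq_nonneg _) k
  have hd' : (1 : ℝ) ≤ d := by exact_mod_cast hd
  rw [Finset.card_univ, Fintype.card_fin, div_le_iff₀' (by positivity)] at h1
  refine h1.trans (mul_le_mul_of_nonneg_right ?_ (Finset.sum_nonneg fun _ _ => by positivity))
  exact pow_le_pow_right₀ hd' (Nat.le_succ k)

theorem order_single (n : Fin d) (l : ℕ) : order (Pi.single n l : MIdx d) = l := by
  simp [order]

/-- A packet of order `N` with `ħ (N + l)` small compared with `b²` is small outside a ball of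
radius `b`. -/
theorem HasExpansion.setIntegral_norm_sq_le {p : PacketData d} {h K Z b C : ℝ} {P : Poly d} {N l : ℕ}
    (hp : Admissible p.A p.B) (hh : 0 < h) (hK0 : 0 ≤ K) (hK : ∀ i j, ‖p.A i j‖ ≤ K)
    (hZ : ‖packetInner p h 1 1‖ ≤ Z) (hb : 0 < b) (hl : 1 ≤ l)
    (hP : HasExpansion (shearMat p.A) P N C) :
    ∫ x in {x | b < ‖x - p.a‖}, ‖polyPacket p h P x‖ ^ 2
      ≤ d * Z * C ^ 2 * (d * h * (2 * d * K) ^ 2 * (N + l) / b ^ 2) ^ l := by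
  have hint := fun Q => integrable_norm_sq_polyPacket hp hh Q
  -- The packet of Q n is ((x_n − a_n)/√ħ)^l times that of P.
  set Q : Fin d → Poly d := fun n => (∏ k, posPoly p.A k ^ (Pi.single n l : MIdx d) k) * P with hQ
  have hQn : ∀ n x, ‖polyPacket p h (Q n) x‖ ^ 2
      = (h⁻¹) ^ l * ((x n - p.a n) ^ 2) ^ l * ‖polyPacket p h P x‖ ^ 2 := by
    intro n x
    have h1 : ∏ k, posPoly p.A k ^ (Pi.single n l : MIdx d) k = posPoly p.A n ^ l := by
      rw [Finset.prod_eq_single_of_mem n (Finset.mem_univ n)]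
      · simp
      · intro k _ hk
        simp [hk]
    have h2 : (|x n - p.a n| / Real.sqrt h) ^ 2 = h⁻¹ * (x n - p.a n) ^ 2 := by
      rw [div_pow, sq_abs, Real.sq_sqrt hh.le]
      ring
    simp only [hQ, h1]
    rw [polyPacket_mul, map_pow, eval_posPoly hp hh, norm_mul, norm_pow, Complex.norm_real,
      Real.norm_eq_abs, abs_div, abs_of_nonneg (Real.sqrt_nonneg h), mul_pow, ← pow_mul, mul_comm l,
      pow_mul, h2, mul_pow]
  have hQi : ∀ n, ∫ x, ‖polyPacket p h (Q n) x‖ ^ 2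
      ≤ Z * ((2 * d * K) ^ 2 * (N + l)) ^ l * C ^ 2 := by
    intro n
    have h1 := (hP.prod_posPoly_mul hp.shearMat_symm hp.mul_shearMat hK hK0
      (Pi.single n l)).integral_norm_sq_le hp hh
    rw [order_single] at h1
    refine h1.trans ?_
    have h2 : ((2 * d * K * Real.sqrt (N + l)) ^ l * C) ^ 2
        = ((2 * d * K) ^ 2 * (N + l)) ^ l * C ^ 2 := by
      rw [mul_pow, ← pow_mul, mul_comm l 2, pow_mul, mul_pow _ (Real.sqrt _),
        Real.sq_sqrt (by positivity)]
    rw [h2, mul_assoc Z]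
    exact mul_le_mul_of_nonneg_right hZ (by positivity)
  have hpt : ∀ x ∈ {x : Conf d | b < ‖x - p.a‖}, ‖polyPacket p h P x‖ ^ 2
      ≤ ((d : ℝ) * h / b ^ 2) ^ l * ∑ n, ‖polyPacket p h (Q n) x‖ ^ 2 := by
    intro x hx
    have hx' : b < ‖x - p.a‖ := hx
    have h1 := norm_sq_pow_le (x - p.a) hl
    simp only [PiLp.sub_apply] at h1
    have h2 : (b ^ 2) ^ l ≤ (d : ℝ) ^ l * ∑ n, ((x n - p.a n) ^ 2) ^ l :=
      le_trans (by gcongr) h1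
    have h3 : ((d : ℝ) * h / b ^ 2) ^ l * ∑ n, ‖polyPacket p h (Q n) x‖ ^ 2
        = ((b ^ 2) ^ l)⁻¹ * ((d : ℝ) ^ l * ∑ n, ((x n - p.a n) ^ 2) ^ l)
          * ‖polyPacket p h P x‖ ^ 2 := by
      simp only [hQn, ← Finset.sum_mul, ← Finset.mul_sum, div_pow, mul_pow, inv_pow]
      field_simp
    rw [h3]
    refine le_mul_of_one_le_left (by positivity) ?_
    rw [← div_eq_inv_mul, one_le_div (by positivity)]
    exact h2
  have hsumint : Integrable
      (fun x => ((d : ℝ) * h / b ^ 2) ^ l * ∑ n, ‖polyPacket p h (Q n) x‖ ^ 2) :=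
    (integrable_finsetSum _ fun n _ => hint (Q n)).const_mul _
  have hmeas : MeasurableSet {x : Conf d | b < ‖x - p.a‖} :=
    measurableSet_lt measurable_const (by fun_prop)
  calc _ ≤ ∫ x in {x | b < ‖x - p.a‖},
        ((d : ℝ) * h / b ^ 2) ^ l * ∑ n, ‖polyPacket p h (Q n) x‖ ^ 2 :=
        setIntegral_mono_on (hint P).integrableOn hsumint.integrableOn hmeas hpt
    _ ≤ ∫ x, ((d : ℝ) * h / b ^ 2) ^ l * ∑ n, ‖polyPacket p h (Q n) x‖ ^ 2 :=
        setIntegral_le_integral hsumint (Filter.Eventually.of_forall fun x =>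
          mul_nonneg (by positivity) (Finset.sum_nonneg fun _ _ => by positivity))
    _ = ((d : ℝ) * h / b ^ 2) ^ l * ∑ n, ∫ x, ‖polyPacket p h (Q n) x‖ ^ 2 := by
        rw [integral_const_mul, integral_finsetSum _ fun n _ => hint (Q n)]
    _ ≤ ((d : ℝ) * h / b ^ 2) ^ l * (d * (Z * ((2 * d * K) ^ 2 * (N + l)) ^ l * C ^ 2)) := by
        refine mul_le_mul_of_nonneg_left ?_ (by positivity)
        refine (Finset.sum_le_card_nsmul _ _ _ fun n _ => hQi n).trans (le_of_eq ?_)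
        simp
    _ = _ := by
        simp only [div_pow, mul_pow]
        ring

theorem norm_truncatedPacket {V : Conf d → ℝ} {p : ℝ → PacketData d} {S : ℝ → ℝ} {J l : ℕ}
    {c₀ : MIdx d → ℂ} {h t : ℝ} (hp : Admissible (p t).A (p t).B) (hh : 0 < h) (x : Conf d) :
    ‖truncatedPacket V p S J c₀ l h t x‖ = ‖polyPacket (p t) h (∑ j ∈ idxLe d (J + 3 * (l - 1)),
      (∑ k ∈ Finset.range l, ((h ^ ((k : ℝ) / 2) : ℝ) : ℂ) * coeff V p h c₀ k t j) •
        hermPoly (shearMat (p t).A) j) x‖ := by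
  have h1 : ‖Complex.exp (Complex.I * (S t : ℂ) / (h : ℂ))‖ = 1 := by
    rw [Complex.norm_exp]
    have : Complex.I * (S t : ℂ) / (h : ℂ) = ((S t / h : ℝ) : ℂ) * Complex.I := by
      push_cast
      ring
    simp [this]
  rw [truncatedPacket, norm_mul, h1, one_mul, polyPacket_sum]
  congr 1
  refine Finset.sum_congr rfl fun j _ => ?_
  rw [polyPacket_smul, phi_eq_polyPacket hp hh]
  rfl

theorem geom_sum_le_pow {x : ℝ} (hx : 2 ≤ x) (l : ℕ) : ∑ k ∈ Finset.range l, x ^ k ≤ x ^ l := by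
  induction l with
  | zero => simp
  | succ l ih =>
    rw [Finset.sum_range_succ, pow_succ]
    have : 0 ≤ x ^ l := by positivity
    nlinarith

/-- The coefficients of the packet truncated at `l` terms grow at most geometrically in `l` as
long as `ħ l ≤ 1`. -/
theorem sum_norm_truncated_le {V : Conf d → ℝ} {T : ℝ} {p : ℝ → PacketData d} {h : ℝ} (hh : 0 < h)
    {c₀ : MIdx d → ℂ} {D ν ω : ℝ} {l : ℕ} (hl : h * l ≤ 1) (hD : 0 ≤ D) (hν : 1 ≤ ν)
    (hω : 0 ≤ ω)
    (hc : ∀ n ≤ l, ∀ t ∈ Set.Icc 0 T, ∀ s : Finset (MIdx d), ∑ j ∈ s, ‖coeff V p h c₀ n t j‖ ≤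
      D * (2 * ν * Real.sqrt l) ^ n * Real.exp (ω * l * t))
    {t : ℝ} (ht : t ∈ Set.Icc 0 T) (s : Finset (MIdx d)) :
    ∑ j ∈ s, ‖∑ k ∈ Finset.range l, ((h ^ ((k : ℝ) / 2) : ℝ) : ℂ) * coeff V p h c₀ k t j‖
      ≤ D * (2 * ν * Real.exp (ω * T)) ^ l := by
  have h1 : ∀ k ∈ Finset.range l, ∑ j ∈ s, ‖((h ^ ((k : ℝ) / 2) : ℝ) : ℂ) * coeff V p h c₀ k t j‖
      ≤ D * Real.exp (ω * T) ^ l * (2 * ν) ^ k := by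
    intro k hk
    have h2 : h ^ ((k : ℝ) / 2) = Real.sqrt h ^ k := by
      rw [Real.sqrt_eq_rpow, ← Real.rpow_natCast, ← Real.rpow_mul hh.le]
      congr 1
      ring
    -- The decisive cancellation: ħ^{k/2} absorbs the growth l^{k/2} of the k-th coefficient.
    have h3 : Real.sqrt h * Real.sqrt l ≤ 1 := by
      rw [← Real.sqrt_mul hh.le]
      exact Real.sqrt_le_one.2 hl
    simp only [norm_mul, Complex.norm_real, ← Finset.mul_sum]
    rw [h2, Real.norm_of_nonneg (by positivity)]
    calc _ ≤ Real.sqrt h ^ k * (D * (2 * ν * Real.sqrt l) ^ k * Real.exp (ω * l * t)) := by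
          gcongr
          exact hc k (Finset.mem_range.1 hk).le t ht s
      _ = D * (2 * ν) ^ k * (Real.sqrt h * Real.sqrt l) ^ k * Real.exp (ω * l * t) := by
          simp only [mul_pow]
          ring
      _ ≤ D * (2 * ν) ^ k * 1 * Real.exp (l * (ω * T)) := by
          have h4 : (Real.sqrt h * Real.sqrt l) ^ k ≤ 1 := pow_le_one₀ (by positivity) h3
          have h5 : ω * l * t ≤ l * (ω * T) := by
            have := mul_le_mul_of_nonneg_left ht.2 (by positivity : 0 ≤ ω * l)
            linarith
          gcongr
      _ = _ := by
          rw [Real.exp_nat_mul]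
          ring
  calc _ ≤ ∑ j ∈ s, ∑ k ∈ Finset.range l,
        ‖((h ^ ((k : ℝ) / 2) : ℝ) : ℂ) * coeff V p h c₀ k t j‖ :=
        Finset.sum_le_sum fun j _ => norm_sum_le _ _
    _ = ∑ k ∈ Finset.range l, ∑ j ∈ s,
        ‖((h ^ ((k : ℝ) / 2) : ℝ) : ℂ) * coeff V p h c₀ k t j‖ := Finset.sum_comm
    _ ≤ ∑ k ∈ Finset.range l, D * Real.exp (ω * T) ^ l * (2 * ν) ^ k := Finset.sum_le_sum h1
    _ ≤ D * Real.exp (ω * T) ^ l * (2 * ν) ^ l := by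
        rw [← Finset.mul_sum]
        exact mul_le_mul_of_nonneg_left (geom_sum_le_pow (by linarith) l) (by positivity)
    _ = _ := by
        rw [mul_pow (2 * ν)]
        ring

/-- With order at most J + 3(l − 1), the quantity N + l is at most (J + 4) l, and ħ l ≤ g turns the
tail bound into (Y θ g)^l ≤ exp(−2l). Finally l ≥ g/(2ħ). -/
theorem pow_bound_le_exp {d J l : ℕ} {K Z D E b g h : ℝ} (hg : 0 ≤ g) (hZ : 0 ≤ Z)
    (hb : 0 < b) (hl : 1 ≤ l) (hlg : h * l ≤ g) (hgl : g / h ≤ 2 * l)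
    (hgs : (d * Z * D ^ 2 + 1) * (d * (2 * d * K) ^ 2 * (J + 4) / b ^ 2 * E ^ 2) * g
      ≤ Real.exp (-2)) (hh : 0 < h) :
    d * Z * (D * E ^ l) ^ 2 *
      (d * h * (2 * d * K) ^ 2 * ((J + 3 * (l - 1) : ℕ) + l) / b ^ 2) ^ l
      ≤ Real.exp (-(g / 2) / h) ^ 2 := by
  set Y := d * Z * D ^ 2 + 1 with hY
  have hY1 : 1 ≤ Y := by
    have : 0 ≤ d * Z * D ^ 2 := by positivity
    linarith
  set θ := d * (2 * d * K) ^ 2 * (J + 4) / b ^ 2 * E ^ 2 with hθ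
  have hθ0 : 0 ≤ θ := by positivity
  set W : ℝ := ((J + 3 * (l - 1) : ℕ) : ℝ) + l with hW
  have hW0 : 0 ≤ W := by positivity
  have h1 : W ≤ (J + 4) * l := by
    have h2 : J + 3 * (l - 1) + l ≤ (J + 4) * l := by
      have : J ≤ J * l := Nat.le_mul_of_pos_right J hl
      have e : (J + 4) * l = J * l + 4 * l := by ring
      omega
    rw [hW]
    exact_mod_cast h2
  have h3 : d * h * (2 * d * K) ^ 2 * W / b ^ 2 * E ^ 2 ≤ θ * g := by
    calc _ ≤ d * h * (2 * d * K) ^ 2 * ((J + 4) * l) / b ^ 2 * E ^ 2 := by gcongr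
      _ = θ * (h * l) := by rw [hθ]; ring
      _ ≤ θ * g := by gcongr
  -- The 1 added in Y gives Y ≥ 1, so the prefactor fits into an l-th power.
  have h4 : d * Z * D ^ 2 ≤ Y ^ l := by
    have : Y ≤ Y ^ l := le_self_pow₀ hY1 (by omega)
    linarith
  calc _ = d * Z * D ^ 2 * (d * h * (2 * d * K) ^ 2 * W / b ^ 2 * E ^ 2) ^ l := by
        rw [mul_pow _ (E ^ 2), ← pow_mul, mul_pow D, ← pow_mul, mul_comm l 2]
        ring
    _ ≤ Y ^ l * (θ * g) ^ l := by gcongr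
    _ = (Y * θ * g) ^ l := by rw [← mul_pow]; ring
    _ ≤ Real.exp (-2) ^ l := by gcongr
    _ = Real.exp (-l) ^ 2 := by
        rw [← Real.exp_nat_mul, ← Real.exp_nat_mul]
        congr 1
        push_cast
        ring
    _ ≤ _ := by
        gcongr
        rw [neg_div, neg_le_neg_iff, div_right_comm]
        linarith

end

end SemiclassicalPacket

/-! ### Choice of the constants and conclusion -/

open SemiclassicalPacket in
theorem theorem3p2 (d : ℕ) (V : SemiclassicalPacket.Conf d → ℝ)
    (hbelow : ∃ v₀ : ℝ, ∀ x, v₀ ≤ V x)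
    (δ M τ : ℝ) (hδ : 0 < δ) (hM : 0 < M) (hτ : 0 < τ)
    (hV : SemiclassicalPacket.HasStripExtension V δ M τ)
    (T : ℝ) (hT : 0 < T)
    (p : ℝ → SemiclassicalPacket.PacketData d) (S : ℝ → ℝ)
    (hflow : SemiclassicalPacket.IsClassicalFlow V T p S)
    (J : ℕ) (c₀ : SemiclassicalPacket.MIdx d → ℂ)
    (hsupp : ∀ j, J < SemiclassicalPacket.order j → c₀ j = 0)
    (hnorm : ∑ j ∈ SemiclassicalPacket.idxLe d J, ‖c₀ j‖ ^ 2 = 1)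
    (b : ℝ) (hb : 0 < b) :
    ∃ G : ℝ, 0 < G ∧ ∀ g : ℝ, 0 < g → g < G →
      ∃ Γ : ℝ, 0 < Γ ∧ ∀ h : ℝ, 0 < h → ∀ t ∈ Set.Icc 0 T,
        MeasureTheory.IntegrableOn
          (fun x => ‖SemiclassicalPacket.approxPacket V p S J c₀ g h t x‖ ^ 2)
          {x | b < ‖x - (p t).a‖} ∧
        Real.sqrt (∫ x in {x | b < ‖x - (p t).a‖},
          ‖SemiclassicalPacket.approxPacket V p S J c₀ g h t x‖ ^ 2)
          ≤ Real.exp (-Γ / h) := by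
  have hV2 := contDiff_of_hasStripExtension hδ hV
  have hadm : ∀ t ∈ Set.Icc 0 T, Admissible (p t).A (p t).B := fun t ht => hflow.admissible hV2 ht
  obtain ⟨K, hK0, hK⟩ := hflow.exists_bound_A
  obtain ⟨R, hR⟩ := hflow.exists_bound_a
  obtain ⟨ρ, hρ0, hρ⟩ := hflow.exists_bound_rootDet hV2
  obtain ⟨C, hC0, r, hr0, hCr⟩ := exists_taylor_bound hδ hM hτ hV R
  set Z := ρ ^ 2 * ((d * K) ^ 2 + 1) ^ ((d : ℝ) / 2) with hZdef
  have hZ0 : 0 < Z := by positivity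
  have hZ : ∀ t ∈ Set.Icc 0 T, ∀ h : ℝ, 0 < h → ‖packetInner (p t) h 1 1‖ ≤ Z := fun t ht h hh =>
    (norm_packetInner_one_le (hadm t ht) hh (hK t ht)).trans (by
      have := hρ t ht
      rw [hZdef]
      gcongr)
  -- The summand 1 ensures ν ≥ 1, so that the geometric sum of ratio 2ν is bounded by (2ν)^l.
  set κ := d * r * (2 * d * K) + 1 with hκ
  have hκ1 : 1 ≤ κ := by
    have : 0 ≤ d * r * (2 * d * K) := by positivity
    linarith
  set ν := κ * Real.sqrt (J + 3) with hν
  have hν1 : 1 ≤ ν := by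
    have : 1 ≤ Real.sqrt (J + 3) := Real.one_le_sqrt.2 (by
      have : (0 : ℝ) ≤ J := Nat.cast_nonneg J
      linarith)
    nlinarith
  set D := ∑ j ∈ idxLe d J, ‖c₀ j‖ with hD
  have hD0 : 0 ≤ D := Finset.sum_nonneg fun _ _ => norm_nonneg _
  set ω := C * Z * ν ^ 2 with hω
  have hω0 : 0 ≤ ω := by positivity
  set E := 2 * ν * Real.exp (ω * T) with hE
  have hcoeff : ∀ h : ℝ, 0 < h → ∀ l : ℕ, 1 ≤ l → ∀ n ≤ l, ∀ t ∈ Set.Icc 0 T,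
      ∀ s : Finset (MIdx d), ∑ j ∈ s, ‖coeff V p h c₀ n t j‖ ≤
        D * (2 * ν * Real.sqrt l) ^ n * Real.exp (ω * l * t) := by
    intro h hh l hl n hn
    refine sum_norm_coeff_le hsupp (fun t ht k j i hji => Kmat_eq_zero (hadm t ht) hh k j i hji)
      (by positivity) (by linarith) (fun t ht k i s => ?_) l hl n hn
    refine (sum_norm_Kmat_le (hadm t ht) hh hK0.le (hK t ht) (hZ t ht h hh) hC0.le hr0.le
      (hCr _ (hR t ht)) k i s).trans ?_
    have : d * r * (2 * d * K) ≤ κ := by linarith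
    gcongr
  set Y := d * Z * D ^ 2 + 1 with hY
  have hY1 : 1 ≤ Y := by
    have : 0 ≤ d * Z * D ^ 2 := by positivity
    linarith
  set θ := d * (2 * d * K) ^ 2 * (J + 4) / b ^ 2 * E ^ 2 with hθ
  have hθ0 : 0 ≤ θ := by positivity
  -- The bound 1 gives ħ l ≤ 1, and the other gives Y θ g ≤ exp(−2); θ + 1 replaces θ, which may be
  -- 0. The rate g/2 comes from ⌊g/ħ⌋ ≥ g/(2ħ).
  refine ⟨min 1 (Real.exp (-2) / (Y * (θ + 1))), by positivity, fun g hg hgG => ⟨g / 2, by positivity,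
    fun h hh t ht => ?_⟩⟩
  have hg1 : g ≤ 1 := (hgG.trans_le (min_le_left _ _)).le
  have hg2 : Y * θ * g ≤ Real.exp (-2) := by
    have h1 := (hgG.trans_le (min_le_right _ _)).le
    rw [le_div_iff₀ (by positivity)] at h1
    refine le_trans ?_ h1
    have : 0 ≤ Y * g := by positivity
    nlinarith
  have hp := hadm t ht
  set l := ⌊g / h⌋₊ with hl
  simp only [approxPacket, ← hl, norm_truncatedPacket hp hh]
  refine ⟨(integrable_norm_sq_polyPacket hp hh _).integrableOn, ?_⟩
  rcases Nat.eq_zero_or_pos l with hl0 | hl1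
  -- For l = 0 the truncated subtraction leaves the index set of order at most J, but every
  -- coefficient is an empty sum, so the packet vanishes.
  · have : ∀ x, polyPacket (p t) h 0 x = 0 := fun x => by simp [polyPacket]
    simp only [hl0, Finset.range_zero, Finset.sum_empty, zero_smul, Finset.sum_const_zero, this,
      norm_zero]
    simp [Real.exp_nonneg]
  have hlg : h * l ≤ g := by
    have := Nat.floor_le (div_nonneg hg.le hh.le)
    rw [← hl, le_div_iff₀ hh] at this
    linarith
  have hl2 : g / h ≤ 2 * l := by
    have h1 : g / h < l + 1 := Nat.lt_floor_add_one _
    have h2 : (1 : ℝ) ≤ l := by exact_mod_cast hl1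
    linarith
  have hexp : HasExpansion (shearMat (p t).A) _ (J + 3 * (l - 1)) (D * E ^ l) :=
    ⟨fun j => ∑ k ∈ Finset.range l, ((h ^ ((k : ℝ) / 2) : ℝ) : ℂ) * coeff V p h c₀ k t j, rfl,
      sum_norm_truncated_le hh (hlg.trans hg1) hD0 hν1 hω0 (hcoeff h hh l hl1) ht _⟩
  have hmain := hexp.setIntegral_norm_sq_le hp hh hK0.le (hK t ht) (hZ t ht h hh) hb hl1
  have hbound := pow_bound_le_exp (d := d) (K := K) hg.le hZ0.le hb hl1 hlg hl2 hg2 hh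
  rw [← Real.sqrt_sq (Real.exp_nonneg (-(g / 2) / h))]
  exact Real.sqrt_le_sqrt (hmain.trans hbound)
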